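/- Let $H_1,H_2$ be complex Hilbert spaces, $H=H_1\oplus H_2$, and let $$T^\circ=\begin{pmatrix}T_{11}^\circ&T_{12}^\circ\\ T_{21}^\circ&T_{22}^\circ\end{pmatrix}$$ be a densely defined symmetric operator matrix in $H$ with domain $\operatorname{dom}T_{11}^\circ\oplus\operatorname{dom}T_{22}^\circ$, where $T_{j1}^\circ:\operatorname{dom}T_{11}^\circ\to H_j$ and $T_{j2}^\circ:\operatorname{dom}T_{22}^\circ\to H_j$. Let $T_{11}^\circ$ be bounded below and $T_{22}^\circ$ bounded above, and fix $\varkappa,\tau\in\mathbb R$ such that $\langle(T_{11}^\circ-\varkappa)y,y\rangle\ge\|y\|^2$ for $y\in\operatorname{dom}T_{11}^\circ$ and $\langle(\tau-T_{22}^\circ)y,y\rangle\ge\|y\|^2$ for $y\in\operatorname{dom}T_{22}^\circ$. Let $D_2$ be the completion of $\operatorname{dom}T_{22}^\circ$ in the norm $\langle(\tau-T_{22}^\circ)y,y\rangle^{1/2}$, let $I_2:D_2\to H_2$ be the canonical embedding, let $T_{22}:D_2\to D_2^*$ be the bounded extension of $I_2^*T_{22}^\circ I_2$, and let $T_{22}^\bullet=(I_2^*)^{-1}T_{22}I_2^{-1}$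 be the Friedrichs extension of $T_{22}^\circ$. Let $D_1$ be the completion of $\operatorname{dom}T_{11}^\circ$ in the norm $$\bigl[\langle(T_{11}^\circ-\varkappa)y,y\rangle+\langle(\tau-T_{22}^\bullet)^{-1}T_{21}^\circ y,T_{21}^\circ y\rangle\bigr]^{1/2},$$ let $I_1:D_1\to H_1$ be the canonical embedding, and put $D=D_1\oplus D_2$, $I=I_1\oplus I_2$. Here $D_j^*,D^*$ are the spaces of bounded conjugate-linear functionals. Let $T_{ij}:D_j\to D_i^*$ be the bounded extension by continuity of $I_i^*T_{ij}^\circ I_j$, let $T=(T_{ij}):D\to D^*$, and let $T^\bullet=(I^*)^{-1}TI^{-1}$ (the angular extension of $T^\circ$, an operator in $H$). Write $\varrho(\cdot)$ for the resolvent set, and for $\lambda\in\varrho(T_{22}^\bullet)$ put $$S(\lambda)=T_{11}-\lambda I_1^*I_1-T_{12}\,[T_{22}-\lambda I_2^*I_2]^{-1}\,T_{21}:\ D_1\to D_1^*.$$ An operator $A:D_1\to D_1^*$ is called uniformly positive if, for some $\varepsilon>0$, $\langle Ay,y\rangle$ is real and $\langle Ay,y\rangle\ge\varepsilon\|y\|_{D_1}^2$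 for all $y\in D_1$, and uniformly negative if $-A$ is uniformly positive. A compact perturbation of $A$ is an operator $A+K$ with $K$ compact. Let $\zeta\in\mathbb R\cap\varrho(T_{22}^\bullet)$ be an eigenvalue of $T^\bullet$ of finite multiplicity which is isolated in the spectrum of $T^\bullet$. 1. Suppose that for some real $\zeta^-<\zeta$ one has $[\zeta^-,\zeta)\subseteq\varrho(T^\bullet)\cap\varrho(T_{22}^\bullet)$ and that $S(\zeta^-)$ is a compact perturbation of a uniformly positive operator. Then there is a real $\zeta^+>\zeta$ such that $(\zeta,\zeta^+]\subseteq\varrho(T^\bullet)\cap\varrho(T_{22}^\bullet)$ and $S(\zeta^+)$ is a compact perturbation of a uniformly positive operator. 2. Suppose that for some real $\zeta^+>\zeta$ one has $(\zeta,\zeta^+]\subseteq\varrho(T^\bullet)\cap\varrho(T_{22}^\bullet)$ and that $S(\zeta^+)$ is a compact perturbation of a uniformly negative operator. Then there is a real $\zeta^-<\zeta$ such that $[\zeta^-,\zeta)\subseteq\varrho(T^\bullet)\cap\varrho(T_{22}^\bullet)$ and $S(\zeta^-)$ is a compact perturbation of a uniformly negative operator. -/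

import Mathlib

open Topology Filter
open scoped InnerProductSpace

set_option linter.unusedSectionVars false

noncomputable section

/-! ### Unbounded operators: resolvent set, resolvent, isolated eigenvalues -/

namespace LinearPMap

variable {E : Type*} [NormedAddCommGroup E] [NormedSpace ℂ E]

/-- `R` is an everywhere defined bounded two-sided inverse of `A - μ`. -/
def IsBoundedInverseAt (A : E →ₗ.[ℂ] E) (μ : ℂ) (R : E →L[ℂ] E) : Prop :=
  (∀ x : E, ∃ h : R x ∈ A.domain, A ⟨R x, h⟩ - μ • R x = x) ∧
    ∀ x : A.domain, R (A x - μ • (x : E)) = x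

/-- The resolvent set of an unbounded operator. -/
def resolventSet (A : E →ₗ.[ℂ] E) : Set ℂ :=
  {μ | ∃ R : E →L[ℂ] E, A.IsBoundedInverseAt μ R}

open Classical in
/-- The resolvent `(A - μ)⁻¹` (the value `0` is assigned outside the resolvent set). -/
def resolventAt (A : E →ₗ.[ℂ] E) (μ : ℂ) : E →L[ℂ] E :=
  if h : ∃ R : E →L[ℂ] E, A.IsBoundedInverseAt μ R then h.choose else 0

/-- The kernel of `A - μ`. -/
def eigenspaceAt (A : E →ₗ.[ℂ] E) (μ : ℂ) : Submodule ℂ E where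
  carrier := {x | ∃ h : x ∈ A.domain, A ⟨x, h⟩ = μ • x}
  zero_mem' := ⟨A.domain.zero_mem, by
    rw [smul_zero]; exact A.map_zero⟩
  add_mem' := by
    rintro x y ⟨hx, ex⟩ ⟨hy, ey⟩
    refine ⟨A.domain.add_mem hx hy, ?_⟩
    have := A.map_add ⟨x, hx⟩ ⟨y, hy⟩
    rw [ex, ey, ← smul_add] at this
    exact this
  smul_mem' := by
    rintro c x ⟨hx, ex⟩
    refine ⟨A.domain.smul_mem c hx, ?_⟩
    have := A.map_smul c ⟨x, hx⟩
    rw [ex, smul_comm] at this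
    exact this

/-- `μ` is an eigenvalue of `A` of finite multiplicity which is isolated in the spectrum. -/
def IsIsolatedEigenvalueOfFiniteMultiplicity (A : E →ₗ.[ℂ] E) (μ : ℂ) : Prop :=
  A.eigenspaceAt μ ≠ ⊥ ∧ FiniteDimensional ℂ (A.eigenspaceAt μ) ∧
    ∀ᶠ ν in 𝓝[≠] μ, ν ∈ A.resolventSet

theorem IsBoundedInverseAt.unique {A : E →ₗ.[ℂ] E} {μ : ℂ} {R R' : E →L[ℂ] E}
    (h : A.IsBoundedInverseAt μ R) (h' : A.IsBoundedInverseAt μ R') : R = R' := by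
  ext x
  obtain ⟨hx, ex⟩ := h.1 x
  have := h'.2 ⟨R x, hx⟩
  rw [ex] at this
  exact this.symm

theorem IsBoundedInverseAt.resolventAt_eq {A : E →ₗ.[ℂ] E} {μ : ℂ} {R : E →L[ℂ] E}
    (h : A.IsBoundedInverseAt μ R) : A.resolventAt μ = R := by
  have hex : ∃ R : E →L[ℂ] E, A.IsBoundedInverseAt μ R := ⟨R, h⟩
  rw [resolventAt, dif_pos hex]
  exact hex.choose_spec.unique h

end LinearPMap

/-! ### Operators in the rigging `D → H → D*` -/

namespace Rigging

variable {D H : Type*} [NormedAddCommGroup D] [InnerProductSpace ℂ D]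
  [NormedAddCommGroup H] [InnerProductSpace ℂ H]

/-- The space `D*` of bounded conjugate-linear functionals on `D`. For `T : D →L[ℂ] Antidual D`,
the number `T y z` is the value `⟨T y, z⟩` of the sesquilinear form of `T`. -/
abbrev Antidual (D : Type*) [NormedAddCommGroup D] [InnerProductSpace ℂ D] : Type _ :=
  D →L⋆[ℂ] ℂ

/-- The adjoint `I* : H → D*` of a bounded operator `I : D → H`: `⟨I* x, z⟩ = ⟨x, I z⟩`
(the inner product of Mathlib is linear in its second argument). -/
def antiadjoint (I : D →L[ℂ] H) : H →L[ℂ] Antidual D :=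
  LinearMap.mkContinuous
    { toFun := fun x => (innerSLFlip ℂ x).comp I
      map_add' := fun x y => by ext z; simp
      map_smul' := fun c x => by ext z; simp }
    ‖I‖ (fun x => by
      refine ContinuousLinearMap.opNorm_le_bound _ (by positivity) fun z => ?_
      have h1 : ‖⟪I z, x⟫_ℂ‖ ≤ ‖I z‖ * ‖x‖ := norm_inner_le_norm _ _
      have h2 : ‖I z‖ ≤ ‖I‖ * ‖z‖ := I.le_opNorm z
      have h3 : ‖I z‖ * ‖x‖ ≤ ‖I‖ * ‖z‖ * ‖x‖ := by gcongr
      calc ‖⟪I z, x⟫_ℂ‖ ≤ ‖I‖ * ‖z‖ * ‖x‖ := h1.trans h3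
        _ = ‖I‖ * ‖x‖ * ‖z‖ := by ring)

@[simp]
theorem antiadjoint_apply (I : D →L[ℂ] H) (x : H) (z : D) : antiadjoint I x z = ⟪I z, x⟫_ℂ := rfl

/-- The graph of `T^• = (I*)⁻¹ T I⁻¹`. -/
def bulletGraph (I : D →L[ℂ] H) (T : D →L[ℂ] Antidual D) : Submodule ℂ (H × H) where
  carrier := {p | ∃ y : D, I y = p.1 ∧ T y = antiadjoint I p.2}
  zero_mem' := ⟨0, by simp, by simp⟩
  add_mem' := by
    rintro p q ⟨y, h1, h2⟩ ⟨z, h3, h4⟩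
    exact ⟨y + z, by simp [h1, h3], by simp [h2, h4]⟩
  smul_mem' := by
    rintro c p ⟨y, h1, h2⟩
    exact ⟨c • y, by simp [h1], by simp [h2]⟩

/-- The operator `T^• = (I*)⁻¹ T I⁻¹` in `H`, for an injective `I` with dense range. -/
def bullet (I : D →L[ℂ] H) (T : D →L[ℂ] Antidual D) : H →ₗ.[ℂ] H :=
  (bulletGraph I T).toLinearPMap

theorem antiadjoint_injective {I : D →L[ℂ] H} (hI : DenseRange I) : Function.Injective (antiadjoint I) := by
  rw [injective_iff_map_eq_zero]
  intro x hx
  refine hI.eq_zero_of_inner_right ℂ (x := x) ?_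
  intro z
  have := congrArg (fun f : Antidual D => f z) hx
  simpa using this

/-- For an injective `I` with dense range, `bullet I T` is exactly `(I*)⁻¹ T I⁻¹`. -/
theorem bullet_graph {I : D →L[ℂ] H} (hI : Function.Injective I) (hd : DenseRange I)
    (T : D →L[ℂ] Antidual D) : (bullet I T).graph = bulletGraph I T := by
  refine Submodule.toLinearPMap_graph_eq _ ?_
  rintro ⟨x, w⟩ ⟨y, h1, h2⟩ hx
  have hy : y = 0 := hI (by rw [h1, map_zero]; exact hx)
  subst hy
  refine antiadjoint_injective hd ?_
  simpa using h2.symm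

/-- A uniformly positive operator `D → D*`: its quadratic form is real and bounded below by
`ε ‖y‖²` for some `ε > 0`. -/
def UniformlyPositive (A : D →L[ℂ] Antidual D) : Prop :=
  ∃ ε : ℝ, 0 < ε ∧ ∀ y : D, (A y y).im = 0 ∧ ε * ‖y‖ ^ 2 ≤ (A y y).re

/-- A uniformly negative operator `D → D*`. -/
def UniformlyNegative (A : D →L[ℂ] Antidual D) : Prop :=
  UniformlyPositive (-A)

/-- A compact perturbation of a uniformly positive operator. -/
def IsCompactPerturbationOfUniformlyPositive (S : D →L[ℂ] Antidual D) : Prop :=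
  ∃ A K : D →L[ℂ] Antidual D, UniformlyPositive A ∧ IsCompactOperator K ∧ S = A + K

/-- A compact perturbation of a uniformly negative operator. -/
def IsCompactPerturbationOfUniformlyNegative (S : D →L[ℂ] Antidual D) : Prop :=
  ∃ A K : D →L[ℂ] Antidual D, UniformlyNegative A ∧ IsCompactOperator K ∧ S = A + K

end Rigging

/-! ### Symmetric operator matrices -/

/-- A symmetric operator matrix `T° = (T₁₁° T₁₂°; T₂₁° T₂₂°)` in `H₁ ⊕ H₂` with domain
`dom T₁₁° ⊕ dom T₂₂°`, dense in `H₁ ⊕ H₂`. -/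
structure SymmetricOperatorMatrix (H₁ H₂ : Type*)
    [NormedAddCommGroup H₁] [InnerProductSpace ℂ H₁]
    [NormedAddCommGroup H₂] [InnerProductSpace ℂ H₂] where
  /-- the entry `T₁₁°` -/
  t₁₁ : H₁ →ₗ.[ℂ] H₁
  /-- the entry `T₂₂°` -/
  t₂₂ : H₂ →ₗ.[ℂ] H₂
  /-- the entry `T₁₂°`, with the same domain as `T₂₂°` -/
  t₁₂ : t₂₂.domain →ₗ[ℂ] H₁
  /-- the entry `T₂₁°`, with the same domain as `T₁₁°` -/
  t₂₁ : t₁₁.domain →ₗ[ℂ] H₂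
  dense₁ : Dense (t₁₁.domain : Set H₁)
  dense₂ : Dense (t₂₂.domain : Set H₂)
  symm : ∀ (x₁ y₁ : t₁₁.domain) (x₂ y₂ : t₂₂.domain),
    ⟪t₁₁ x₁ + t₁₂ x₂, (y₁ : H₁)⟫_ℂ + ⟪t₂₁ x₁ + t₂₂ x₂, (y₂ : H₂)⟫_ℂ =
      ⟪(x₁ : H₁), t₁₁ y₁ + t₁₂ y₂⟫_ℂ + ⟪(x₂ : H₂), t₂₁ y₁ + t₂₂ y₂⟫_ℂ

/-- A symmetric operator matrix with `T₁₁°` bounded below and `T₂₂°` bounded above, together with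
a choice of real numbers `κ`, `τ` such that `T₁₁° - κ ≥ 1` and `τ - T₂₂° ≥ 1`. -/
structure SemiboundedOperatorMatrix (H₁ H₂ : Type*)
    [NormedAddCommGroup H₁] [InnerProductSpace ℂ H₁]
    [NormedAddCommGroup H₂] [InnerProductSpace ℂ H₂]
    extends SymmetricOperatorMatrix H₁ H₂ where
  /-- the shift `κ` -/
  κ : ℝ
  /-- the shift `τ` -/
  τ : ℝ
  lower : ∀ y : t₁₁.domain,
    ‖(y : H₁)‖ ^ 2 ≤ (⟪(y : H₁), t₁₁ y - (κ : ℂ) • (y : H₁)⟫_ℂ).re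
  upper : ∀ y : t₂₂.domain,
    ‖(y : H₂)‖ ^ 2 ≤ (⟪(y : H₂), (τ : ℂ) • (y : H₂) - t₂₂ y⟫_ℂ).re

namespace SemiboundedOperatorMatrix

open Rigging

variable {H₁ H₂ : Type*}
  [NormedAddCommGroup H₁] [InnerProductSpace ℂ H₁]
  [NormedAddCommGroup H₂] [InnerProductSpace ℂ H₂]
  (M : SemiboundedOperatorMatrix H₁ H₂)

theorem symm₁₁ (x y : M.t₁₁.domain) : ⟪M.t₁₁ x, (y : H₁)⟫_ℂ = ⟪(x : H₁), M.t₁₁ y⟫_ℂ := by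
  simpa using M.symm x y 0 0

theorem symm₂₂ (x y : M.t₂₂.domain) : ⟪M.t₂₂ x, (y : H₂)⟫_ℂ = ⟪(x : H₂), M.t₂₂ y⟫_ℂ := by
  simpa using M.symm 0 0 x y

theorem symm₂₁ (x : M.t₁₁.domain) (y : M.t₂₂.domain) :
    ⟪M.t₂₁ x, (y : H₂)⟫_ℂ = ⟪(x : H₁), M.t₁₂ y⟫_ℂ := by
  simpa using M.symm x 0 0 y

/-! #### The space `D₂` and the Friedrichs extension `T₂₂^•` -/

/-- The domain of `T₂₂°`, to be equipped with the norm of `D₂`. -/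
def Dom₂ : Type _ := M.t₂₂.domain

instance : AddCommGroup M.Dom₂ := inferInstanceAs (AddCommGroup M.t₂₂.domain)

instance : Module ℂ M.Dom₂ := inferInstanceAs (Module ℂ M.t₂₂.domain)

/-- The vector of the domain of `T₂₂°`, without the norm of `D₂`. -/
def Dom₂.val : M.Dom₂ →ₗ[ℂ] M.t₂₂.domain := LinearMap.id

/-- The inner product `⟨(τ - T₂₂°) x, y⟩` on the domain of `T₂₂°`. -/
@[reducible]
def core₂ : InnerProductSpace.Core ℂ M.Dom₂ where
  inner x y := ⟪(Dom₂.val M x : H₂), (M.τ : ℂ) • (Dom₂.val M y : H₂) - M.t₂₂ (Dom₂.val M y)⟫_ℂ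
  conj_inner_symm x y := by
    rw [inner_conj_symm, inner_sub_left, inner_sub_right, M.symm₂₂, inner_smul_left,
      inner_smul_right, Complex.conj_ofReal]
  re_inner_nonneg x := le_trans (by positivity) (M.upper (Dom₂.val M x))
  add_left x y z := by
    simp only [map_add, Submodule.coe_add, inner_add_left]
  smul_left x y r := by
    simp only [map_smul, Submodule.coe_smul, inner_smul_left]
  definite x hx := by
    have h := M.upper (Dom₂.val M x)
    rw [hx] at h
    have h0 : ‖(Dom₂.val M x : H₂)‖ = 0 := by
      have := norm_nonneg (Dom₂.val M x : H₂)
      simp only [Complex.zero_re] at h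
      nlinarith
    exact Subtype.ext (norm_eq_zero.mp h0)

instance : NormedAddCommGroup M.Dom₂ := M.core₂.toNormedAddCommGroup

instance : InnerProductSpace ℂ M.Dom₂ := InnerProductSpace.ofCore M.core₂.toCore

theorem inner_dom₂ (x y : M.Dom₂) : ⟪x, y⟫_ℂ =
    ⟪(Dom₂.val M x : H₂), (M.τ : ℂ) • (Dom₂.val M y : H₂) - M.t₂₂ (Dom₂.val M y)⟫_ℂ := rfl

/-- The Hilbert space `D₂`, the completion of the domain of `T₂₂°` in the norm
`⟨(τ - T₂₂°) y, y⟩^{1/2}`. -/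
abbrev D₂ : Type _ := UniformSpace.Completion M.Dom₂

/-- The canonical map of the domain of `T₂₂°` to `D₂`. -/
def ι₂ : M.Dom₂ →L[ℂ] M.D₂ := UniformSpace.Completion.toComplL

theorem denseRange_ι₂ : DenseRange M.ι₂ := UniformSpace.Completion.denseRange_coe

theorem inner_ι₂ (x y : M.Dom₂) : ⟪M.ι₂ x, M.ι₂ y⟫_ℂ = ⟪x, y⟫_ℂ :=
  UniformSpace.Completion.inner_coe x y

theorem norm_ι₂ (x : M.Dom₂) : ‖M.ι₂ x‖ = ‖x‖ := UniformSpace.Completion.norm_coe x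

theorem norm_val₂_le (x : M.Dom₂) : ‖(Dom₂.val M x : H₂)‖ ≤ ‖x‖ := by
  have h := M.upper (Dom₂.val M x)
  rw [← inner_dom₂] at h
  have h2 : ‖x‖ ^ 2 = (⟪x, x⟫_ℂ).re := norm_sq_eq_re_inner (𝕜 := ℂ) x
  rw [← h2] at h
  exact le_of_sq_le_sq h (norm_nonneg _)

variable [CompleteSpace H₂]

/-- The embedding `I₂ : D₂ → H₂`, extending the identity of the domain of `T₂₂°` by continuity. -/
def I₂ : M.D₂ →L[ℂ] H₂ :=
  (M.t₂₂.domain.subtype ∘ₗ Dom₂.val M).extendOfNorm (M.ι₂ : M.Dom₂ →ₗ[ℂ] M.D₂)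

@[simp]
theorem I₂_ι₂ (x : M.Dom₂) : M.I₂ (M.ι₂ x) = (Dom₂.val M x : H₂) :=
  LinearMap.extendOfNorm_eq M.denseRange_ι₂
    ⟨1, fun x => by simpa [norm_ι₂] using M.norm_val₂_le x⟩ x

theorem inner_D₂ (x : M.D₂) (y : M.Dom₂) : ⟪x, M.ι₂ y⟫_ℂ =
    ⟪M.I₂ x, (M.τ : ℂ) • (Dom₂.val M y : H₂) - M.t₂₂ (Dom₂.val M y)⟫_ℂ := by
  refine M.denseRange_ι₂.induction_on (p := fun x => ⟪x, M.ι₂ y⟫_ℂ =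
    ⟪M.I₂ x, (M.τ : ℂ) • (Dom₂.val M y : H₂) - M.t₂₂ (Dom₂.val M y)⟫_ℂ) x
    (isClosed_eq (by fun_prop) (by fun_prop)) fun x => ?_
  rw [inner_ι₂, inner_dom₂, I₂_ι₂]

theorem I₂_injective : Function.Injective M.I₂ := by
  rw [injective_iff_map_eq_zero]
  intro x hx
  refine M.denseRange_ι₂.eq_zero_of_inner_left ℂ ?_
  intro y
  rw [inner_D₂, hx, inner_zero_left]

theorem denseRange_I₂ : DenseRange M.I₂ := by
  refine M.dense₂.mono ?_
  intro x hx
  exact ⟨M.ι₂ (⟨x, hx⟩ : M.t₂₂.domain), M.I₂_ι₂ _⟩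

/-- The bounded operator `T₂₂ : D₂ → D₂*`, the extension by continuity of `I₂* T₂₂° I₂`. -/
def T₂₂ : M.D₂ →L[ℂ] Antidual M.D₂ :=
  ((antiadjoint M.I₂ : H₂ →ₗ[ℂ] Antidual M.D₂) ∘ₗ M.t₂₂.toFun ∘ₗ Dom₂.val M).extendOfNorm
    (M.ι₂ : M.Dom₂ →ₗ[ℂ] M.D₂)

/-- A densely defined operator which agrees with a bounded one is extended by it. -/
theorem extendOfNorm_eq_of_eq {E D F : Type*} [AddCommGroup E] [Module ℂ E]
    [NormedAddCommGroup D] [NormedSpace ℂ D] [NormedAddCommGroup F] [NormedSpace ℂ F]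
    [CompleteSpace F] {f : E →ₗ[ℂ] F} {e : E →ₗ[ℂ] D} (he : DenseRange e) (G : D →L[ℂ] F)
    (h : ∀ x, G (e x) = f x) : f.extendOfNorm e = G :=
  LinearMap.extendOfNorm_unique he ‖G‖ (fun x => by rw [← h]; exact G.le_opNorm _) G
    (LinearMap.ext h)

/-- `T₂₂ = τ I₂* I₂ - J`, where `J : D₂ → D₂*` is the Riesz isomorphism. -/
theorem T₂₂_eq : M.T₂₂ = (M.τ : ℂ) • (antiadjoint M.I₂).comp M.I₂ - innerSLFlip ℂ := by
  refine extendOfNorm_eq_of_eq M.denseRange_ι₂ _ fun x => ?_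
  ext z
  simp [inner_D₂]

theorem T₂₂_ι₂ (x : M.Dom₂) : M.T₂₂ (M.ι₂ x) = antiadjoint M.I₂ (M.t₂₂ (Dom₂.val M x)) := by
  rw [T₂₂_eq]
  ext z
  simp [inner_D₂]

/-- The Friedrichs extension `T₂₂^• = (I₂*)⁻¹ T₂₂ I₂⁻¹` of `T₂₂°`. -/
def T₂₂bullet : H₂ →ₗ.[ℂ] H₂ := bullet M.I₂ M.T₂₂

theorem T₂₂bullet_graph : M.T₂₂bullet.graph = bulletGraph M.I₂ M.T₂₂ :=
  bullet_graph M.I₂_injective M.denseRange_I₂ _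

/-- The number `τ` is in the resolvent set of `T₂₂^•`, and `(τ - T₂₂^•)⁻¹ = I₂ I₂^†` with the
Hilbert space adjoint `I₂^† : H₂ → D₂`. -/
theorem resolvent_T₂₂bullet : M.T₂₂bullet.IsBoundedInverseAt (M.τ : ℂ)
    (-(M.I₂.comp M.I₂.adjoint)) := by
  constructor
  · intro x
    have hg : (-(M.I₂ (M.I₂.adjoint x)), x + (M.τ : ℂ) • (-(M.I₂ (M.I₂.adjoint x)))) ∈
        M.T₂₂bullet.graph := by
      rw [T₂₂bullet_graph]
      refine ⟨-(M.I₂.adjoint x), by simp, ?_⟩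
      rw [T₂₂_eq]
      ext z
      simp [ContinuousLinearMap.adjoint_inner_right]
      ring
    obtain ⟨y, hy1, hy2⟩ := (LinearPMap.mem_graph_iff _).1 hg
    simp only at hy1 hy2
    have hm : -(M.I₂ (M.I₂.adjoint x)) ∈ M.T₂₂bullet.domain := hy1 ▸ y.2
    refine ⟨hm, ?_⟩
    have : y = ⟨-(M.I₂ (M.I₂.adjoint x)), hm⟩ := Subtype.ext hy1
    rw [this] at hy2
    change M.T₂₂bullet ⟨-(M.I₂ (M.I₂.adjoint x)), hm⟩ -
      (M.τ : ℂ) • (-(M.I₂ (M.I₂.adjoint x))) = x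
    rw [hy2, add_sub_cancel_right]
  · intro x
    have hg := M.T₂₂bullet.mem_graph x
    rw [T₂₂bullet_graph] at hg
    obtain ⟨y, hy1, hy2⟩ := hg
    simp only at hy1 hy2
    rw [T₂₂_eq] at hy2
    have key : M.I₂.adjoint (M.T₂₂bullet x - (M.τ : ℂ) • (x : H₂)) = -y := by
      refine ext_inner_left ℂ fun z => ?_
      have h := congrArg (fun f : Antidual M.D₂ => f z) hy2
      simp only [sub_apply, smul_apply,
        ContinuousLinearMap.comp_apply, antiadjoint_apply, innerSLFlip_apply_apply,
        hy1, smul_eq_mul] at h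
      rw [ContinuousLinearMap.adjoint_inner_right, inner_sub_right, inner_smul_right, ← h,
        inner_neg_right]
      ring
    change -(M.I₂ (M.I₂.adjoint _)) = _
    rw [key, map_neg, neg_neg, hy1]

theorem resolventAt_T₂₂bullet :
    M.T₂₂bullet.resolventAt (M.τ : ℂ) = -(M.I₂.comp M.I₂.adjoint) :=
  M.resolvent_T₂₂bullet.resolventAt_eq

/-! #### The space `D₁` -/

/-- The domain of `T₁₁°`, to be equipped with the norm of `D₁`. -/
def Dom₁ : Type _ := M.t₁₁.domain

instance : AddCommGroup M.Dom₁ := inferInstanceAs (AddCommGroup M.t₁₁.domain)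

instance : Module ℂ M.Dom₁ := inferInstanceAs (Module ℂ M.t₁₁.domain)

/-- The vector of the domain of `T₁₁°`, without the norm of `D₁`. -/
def Dom₁.val : M.Dom₁ →ₗ[ℂ] M.t₁₁.domain := LinearMap.id

/-- The sesquilinear form `⟨(T₁₁° - κ) x, y⟩ + ⟨(τ - T₂₂^•)⁻¹ T₂₁° x, T₂₁° y⟩`; note that
`(τ - T₂₂^•)⁻¹ = -(T₂₂^• - τ)⁻¹`. -/
def form₁ (x y : M.t₁₁.domain) : ℂ :=
  ⟪(x : H₁), M.t₁₁ y - (M.κ : ℂ) • (y : H₁)⟫_ℂ +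
    ⟪M.t₂₁ x, -(M.T₂₂bullet.resolventAt (M.τ : ℂ) (M.t₂₁ y))⟫_ℂ

theorem form₁_eq (x y : M.t₁₁.domain) : M.form₁ x y =
    ⟪(x : H₁), M.t₁₁ y - (M.κ : ℂ) • (y : H₁)⟫_ℂ +
      ⟪M.I₂.adjoint (M.t₂₁ x), M.I₂.adjoint (M.t₂₁ y)⟫_ℂ := by
  rw [form₁, resolventAt_T₂₂bullet, ContinuousLinearMap.adjoint_inner_left]
  simp

theorem form₁_self_re (x : M.t₁₁.domain) : (M.form₁ x x).re =
    (⟪(x : H₁), M.t₁₁ x - (M.κ : ℂ) • (x : H₁)⟫_ℂ).re + ‖M.I₂.adjoint (M.t₂₁ x)‖ ^ 2 := by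
  rw [form₁_eq, Complex.add_re, inner_self_eq_norm_sq_to_K]
  norm_cast

/-- The inner product of `D₁` on the domain of `T₁₁°`. -/
@[reducible]
def core₁ : InnerProductSpace.Core ℂ M.Dom₁ where
  inner x y := M.form₁ (Dom₁.val M x) (Dom₁.val M y)
  conj_inner_symm x y := by
    rw [form₁_eq, form₁_eq, map_add, inner_conj_symm, inner_conj_symm, inner_sub_left,
      inner_sub_right, M.symm₁₁, inner_smul_left, inner_smul_right, Complex.conj_ofReal]
  re_inner_nonneg x := by
    change 0 ≤ (M.form₁ (Dom₁.val M x) (Dom₁.val M x)).re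
    rw [form₁_self_re]
    have := M.lower (Dom₁.val M x)
    nlinarith [sq_nonneg ‖(Dom₁.val M x : H₁)‖, sq_nonneg ‖M.I₂.adjoint (M.t₂₁ (Dom₁.val M x))‖]
  add_left x y z := by
    simp only [form₁, map_add, Submodule.coe_add, inner_add_left]
    ring
  smul_left x y r := by
    simp only [form₁, map_smul, Submodule.coe_smul, inner_smul_left]
    ring
  definite x hx := by
    have h := M.lower (Dom₁.val M x)
    have h' : (M.form₁ (Dom₁.val M x) (Dom₁.val M x)).re = 0 := by
      rw [hx, Complex.zero_re]
    rw [form₁_self_re] at h'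
    have h0 : ‖(Dom₁.val M x : H₁)‖ = 0 := by
      nlinarith [norm_nonneg (Dom₁.val M x : H₁),
        sq_nonneg ‖M.I₂.adjoint (M.t₂₁ (Dom₁.val M x))‖]
    exact Subtype.ext (norm_eq_zero.mp h0)

instance : NormedAddCommGroup M.Dom₁ := M.core₁.toNormedAddCommGroup

instance : InnerProductSpace ℂ M.Dom₁ := InnerProductSpace.ofCore M.core₁.toCore

theorem inner_dom₁ (x y : M.Dom₁) : ⟪x, y⟫_ℂ = M.form₁ (Dom₁.val M x) (Dom₁.val M y) := rfl

/-- The Hilbert space `D₁`, the completion of the domain of `T₁₁°` in the norm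
`(⟨(T₁₁° - κ) y, y⟩ + ⟨(τ - T₂₂^•)⁻¹ T₂₁° y, T₂₁° y⟩)^{1/2}`. -/
abbrev D₁ : Type _ := UniformSpace.Completion M.Dom₁

/-- The canonical map of the domain of `T₁₁°` to `D₁`. -/
def ι₁ : M.Dom₁ →L[ℂ] M.D₁ := UniformSpace.Completion.toComplL

theorem denseRange_ι₁ : DenseRange M.ι₁ := UniformSpace.Completion.denseRange_coe

theorem inner_ι₁ (x y : M.Dom₁) : ⟪M.ι₁ x, M.ι₁ y⟫_ℂ = ⟪x, y⟫_ℂ :=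
  UniformSpace.Completion.inner_coe x y

theorem norm_ι₁ (x : M.Dom₁) : ‖M.ι₁ x‖ = ‖x‖ := UniformSpace.Completion.norm_coe x

theorem norm_sq_dom₁ (x : M.Dom₁) : ‖x‖ ^ 2 = (⟪(Dom₁.val M x : H₁),
    M.t₁₁ (Dom₁.val M x) - (M.κ : ℂ) • (Dom₁.val M x : H₁)⟫_ℂ).re +
      ‖M.I₂.adjoint (M.t₂₁ (Dom₁.val M x))‖ ^ 2 := by
  rw [← form₁_self_re, ← inner_dom₁]
  exact norm_sq_eq_re_inner (𝕜 := ℂ) x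

theorem norm_val₁_le (x : M.Dom₁) : ‖(Dom₁.val M x : H₁)‖ ≤ ‖x‖ := by
  have h := M.lower (Dom₁.val M x)
  refine le_of_sq_le_sq ?_ (norm_nonneg _)
  rw [norm_sq_dom₁]
  nlinarith [sq_nonneg ‖M.I₂.adjoint (M.t₂₁ (Dom₁.val M x))‖]

theorem norm_adjoint_t₂₁_le (x : M.Dom₁) : ‖M.I₂.adjoint (M.t₂₁ (Dom₁.val M x))‖ ≤ ‖x‖ := by
  have h := M.lower (Dom₁.val M x)
  refine le_of_sq_le_sq ?_ (norm_nonneg _)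
  rw [norm_sq_dom₁]
  nlinarith [sq_nonneg ‖(Dom₁.val M x : H₁)‖]

/-- Auxiliary bounded operator `D₁ → D₂`, the extension by continuity of `I₂^† T₂₁°`; it becomes
`T₂₁` after the Riesz identification of `D₂` with `D₂*`. -/
def V : M.D₁ →L[ℂ] M.D₂ :=
  ((M.I₂.adjoint : H₂ →ₗ[ℂ] M.D₂) ∘ₗ M.t₂₁ ∘ₗ Dom₁.val M).extendOfNorm
    (M.ι₁ : M.Dom₁ →ₗ[ℂ] M.D₁)

@[simp]
theorem V_ι₁ (x : M.Dom₁) : M.V (M.ι₁ x) = M.I₂.adjoint (M.t₂₁ (Dom₁.val M x)) :=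
  LinearMap.extendOfNorm_eq M.denseRange_ι₁
    ⟨1, fun x => by simpa [norm_ι₁] using M.norm_adjoint_t₂₁_le x⟩ x

variable [CompleteSpace H₁]

/-- The embedding `I₁ : D₁ → H₁`, extending the identity of the domain of `T₁₁°` by continuity. -/
def I₁ : M.D₁ →L[ℂ] H₁ :=
  (M.t₁₁.domain.subtype ∘ₗ Dom₁.val M).extendOfNorm (M.ι₁ : M.Dom₁ →ₗ[ℂ] M.D₁)

@[simp]
theorem I₁_ι₁ (x : M.Dom₁) : M.I₁ (M.ι₁ x) = (Dom₁.val M x : H₁) :=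
  LinearMap.extendOfNorm_eq M.denseRange_ι₁
    ⟨1, fun x => by simpa [norm_ι₁] using M.norm_val₁_le x⟩ x

theorem inner_D₁ (x : M.D₁) (y : M.Dom₁) : ⟪x, M.ι₁ y⟫_ℂ =
    ⟪M.I₁ x, M.t₁₁ (Dom₁.val M y) - (M.κ : ℂ) • (Dom₁.val M y : H₁)⟫_ℂ +
      ⟪M.V x, M.V (M.ι₁ y)⟫_ℂ := by
  refine M.denseRange_ι₁.induction_on (p := fun x => ⟪x, M.ι₁ y⟫_ℂ =
    ⟪M.I₁ x, M.t₁₁ (Dom₁.val M y) - (M.κ : ℂ) • (Dom₁.val M y : H₁)⟫_ℂ +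
      ⟪M.V x, M.V (M.ι₁ y)⟫_ℂ) x
    (isClosed_eq (by fun_prop) (by fun_prop)) fun x => ?_
  rw [inner_ι₁, inner_dom₁, I₁_ι₁, form₁_eq, V_ι₁, V_ι₁]

theorem inner_V (x : M.D₁) (z : M.Dom₂) :
    ⟪M.V x, M.ι₂ z⟫_ℂ = ⟪M.I₁ x, M.t₁₂ (Dom₂.val M z)⟫_ℂ := by
  refine M.denseRange_ι₁.induction_on (p := fun x =>
    ⟪M.V x, M.ι₂ z⟫_ℂ = ⟪M.I₁ x, M.t₁₂ (Dom₂.val M z)⟫_ℂ) x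
    (isClosed_eq (by fun_prop) (by fun_prop)) fun x => ?_
  rw [V_ι₁, I₁_ι₁, ContinuousLinearMap.adjoint_inner_left, I₂_ι₂, symm₂₁]

theorem I₁_injective : Function.Injective M.I₁ := by
  rw [injective_iff_map_eq_zero]
  intro x hx
  have hV : M.V x = 0 := by
    refine M.denseRange_ι₂.eq_zero_of_inner_left ℂ ?_
    intro z
    rw [inner_V, hx, inner_zero_left]
  refine M.denseRange_ι₁.eq_zero_of_inner_left ℂ ?_
  intro y
  rw [inner_D₁, hx, hV, inner_zero_left, inner_zero_left, add_zero]

theorem denseRange_I₁ : DenseRange M.I₁ := by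
  refine M.dense₁.mono ?_
  intro x hx
  exact ⟨M.ι₁ (⟨x, hx⟩ : M.t₁₁.domain), M.I₁_ι₁ _⟩

/-! #### The entries `T₁₁`, `T₁₂`, `T₂₁` and the angular extension -/

/-- The bounded operator `T₁₁ : D₁ → D₁*`, the extension by continuity of `I₁* T₁₁° I₁`. -/
def T₁₁ : M.D₁ →L[ℂ] Antidual M.D₁ :=
  ((antiadjoint M.I₁ : H₁ →ₗ[ℂ] Antidual M.D₁) ∘ₗ M.t₁₁.toFun ∘ₗ Dom₁.val M).extendOfNorm
    (M.ι₁ : M.Dom₁ →ₗ[ℂ] M.D₁)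

/-- The bounded operator `T₂₁ : D₁ → D₂*`, the extension by continuity of `I₂* T₂₁° I₁`. -/
def T₂₁ : M.D₁ →L[ℂ] Antidual M.D₂ :=
  ((antiadjoint M.I₂ : H₂ →ₗ[ℂ] Antidual M.D₂) ∘ₗ M.t₂₁ ∘ₗ Dom₁.val M).extendOfNorm
    (M.ι₁ : M.Dom₁ →ₗ[ℂ] M.D₁)

/-- The bounded operator `T₁₂ : D₂ → D₁*`, the extension by continuity of `I₁* T₁₂° I₂`. -/
def T₁₂ : M.D₂ →L[ℂ] Antidual M.D₁ :=
  ((antiadjoint M.I₁ : H₁ →ₗ[ℂ] Antidual M.D₁) ∘ₗ M.t₁₂ ∘ₗ Dom₂.val M).extendOfNorm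
    (M.ι₂ : M.Dom₂ →ₗ[ℂ] M.D₂)

theorem T₁₁_eq : M.T₁₁ = innerSLFlip ℂ - (antiadjoint M.V).comp M.V +
    (M.κ : ℂ) • (antiadjoint M.I₁).comp M.I₁ := by
  refine extendOfNorm_eq_of_eq M.denseRange_ι₁ _ fun x => ?_
  ext z
  simp [inner_D₁]

theorem T₁₁_ι₁ (x : M.Dom₁) : M.T₁₁ (M.ι₁ x) = antiadjoint M.I₁ (M.t₁₁ (Dom₁.val M x)) := by
  rw [T₁₁_eq]
  ext z
  simp [inner_D₁]

theorem T₂₁_eq : M.T₂₁ = (innerSLFlip ℂ).comp M.V := by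
  refine extendOfNorm_eq_of_eq M.denseRange_ι₁ _ fun x => ?_
  ext z
  simp [ContinuousLinearMap.adjoint_inner_right]

theorem T₂₁_ι₁ (x : M.Dom₁) : M.T₂₁ (M.ι₁ x) = antiadjoint M.I₂ (M.t₂₁ (Dom₁.val M x)) := by
  rw [T₂₁_eq]
  ext z
  simp [ContinuousLinearMap.adjoint_inner_right]

theorem T₁₂_eq : M.T₁₂ = antiadjoint M.V := by
  refine extendOfNorm_eq_of_eq M.denseRange_ι₂ _ fun x => ?_
  ext z
  simp [inner_V]

theorem T₁₂_ι₂ (x : M.Dom₂) : M.T₁₂ (M.ι₂ x) = antiadjoint M.I₁ (M.t₁₂ (Dom₂.val M x)) := by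
  rw [T₁₂_eq]
  ext z
  simp [inner_V]

/-- The Hilbert space `H = H₁ ⊕ H₂`. -/
abbrev H (_ : SemiboundedOperatorMatrix H₁ H₂) : Type _ := WithLp 2 (H₁ × H₂)

/-- The Hilbert space `D = D₁ ⊕ D₂`. -/
abbrev D : Type _ := WithLp 2 (M.D₁ × M.D₂)

/-- The embedding `I = I₁ ⊕ I₂ : D → H`. -/
def I : M.D →L[ℂ] M.H :=
  (WithLp.prodContinuousLinearEquiv 2 ℂ H₁ H₂).symm.toContinuousLinearMap.comp
    ((M.I₁.prodMap M.I₂).comp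
      (WithLp.prodContinuousLinearEquiv 2 ℂ M.D₁ M.D₂).toContinuousLinearMap)

/-- The coordinate projection `D → D₁`. -/
def pr₁ : M.D →L[ℂ] M.D₁ :=
  (ContinuousLinearMap.fst ℂ M.D₁ M.D₂).comp
    (WithLp.prodContinuousLinearEquiv 2 ℂ M.D₁ M.D₂).toContinuousLinearMap

/-- The coordinate projection `D → D₂`. -/
def pr₂ : M.D →L[ℂ] M.D₂ :=
  (ContinuousLinearMap.snd ℂ M.D₁ M.D₂).comp
    (WithLp.prodContinuousLinearEquiv 2 ℂ M.D₁ M.D₂).toContinuousLinearMap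

/-- The bounded operator `T : D → D*` with the entries `T₁₁`, `T₁₂`, `T₂₁`, `T₂₂`. -/
def T : M.D →L[ℂ] Antidual M.D :=
  LinearMap.mkContinuous
    { toFun := fun y =>
        (M.T₁₁ (M.pr₁ y) + M.T₁₂ (M.pr₂ y)).comp M.pr₁ +
          (M.T₂₁ (M.pr₁ y) + M.T₂₂ (M.pr₂ y)).comp M.pr₂
      map_add' := fun x y => by ext z; simp; abel
      map_smul' := fun c x => by ext z; simp }
    ((‖M.T₁₁‖ * ‖M.pr₁‖ + ‖M.T₁₂‖ * ‖M.pr₂‖) * ‖M.pr₁‖ +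
      (‖M.T₂₁‖ * ‖M.pr₁‖ + ‖M.T₂₂‖ * ‖M.pr₂‖) * ‖M.pr₂‖) (fun y => by
      have h1 := M.pr₁.le_opNorm y
      have h2 := M.pr₂.le_opNorm y
      refine (norm_add_le _ _).trans ?_
      refine (add_le_add (ContinuousLinearMap.opNorm_comp_le _ _)
        (ContinuousLinearMap.opNorm_comp_le _ _)).trans ?_
      have h3 : ‖M.T₁₁ (M.pr₁ y) + M.T₁₂ (M.pr₂ y)‖ ≤
          ‖M.T₁₁‖ * (‖M.pr₁‖ * ‖y‖) + ‖M.T₁₂‖ * (‖M.pr₂‖ * ‖y‖) :=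
        (norm_add_le _ _).trans (add_le_add (M.T₁₁.le_opNorm_of_le h1) (M.T₁₂.le_opNorm_of_le h2))
      have h4 : ‖M.T₂₁ (M.pr₁ y) + M.T₂₂ (M.pr₂ y)‖ ≤
          ‖M.T₂₁‖ * (‖M.pr₁‖ * ‖y‖) + ‖M.T₂₂‖ * (‖M.pr₂‖ * ‖y‖) :=
        (norm_add_le _ _).trans (add_le_add (M.T₂₁.le_opNorm_of_le h1) (M.T₂₂.le_opNorm_of_le h2))
      refine (add_le_add (mul_le_mul_of_nonneg_right h3 (norm_nonneg _))
        (mul_le_mul_of_nonneg_right h4 (norm_nonneg _))).trans (le_of_eq ?_)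
      ring)

theorem T_apply (y z : M.D) : M.T y z =
    M.T₁₁ y.fst z.fst + M.T₁₂ y.snd z.fst + (M.T₂₁ y.fst z.snd + M.T₂₂ y.snd z.snd) := rfl

theorem I_apply (y : M.D) : M.I y = WithLp.toLp 2 (M.I₁ y.fst, M.I₂ y.snd) := rfl

theorem I_injective : Function.Injective M.I := by
  intro x y h
  rw [I_apply, I_apply] at h
  have h' := congrArg WithLp.ofLp h
  simp only [Prod.mk.injEq] at h'
  have h1 := M.I₁_injective h'.1
  have h2 := M.I₂_injective h'.2
  exact (WithLp.ofLp_injective 2) (Prod.ext h1 h2)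

theorem denseRange_I : DenseRange M.I := by
  have h : DenseRange (Prod.map M.I₁ M.I₂) := M.denseRange_I₁.prodMap M.denseRange_I₂
  have e1 := (WithLp.prodContinuousLinearEquiv 2 ℂ H₁ H₂).symm.surjective.denseRange
  have e2 := (WithLp.prodContinuousLinearEquiv 2 ℂ M.D₁ M.D₂).surjective.denseRange
  exact e1.comp (h.comp e2 (by fun_prop)) (by fun_prop)

/-- The angular extension `T^• = (I*)⁻¹ T I⁻¹` of the operator matrix `T°`. -/
def Tbullet : M.H →ₗ.[ℂ] M.H := bullet M.I M.T

theorem Tbullet_graph : M.Tbullet.graph = bulletGraph M.I M.T :=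
  bullet_graph M.I_injective M.denseRange_I _

/-- The operator `T₂₂ - μ I₂* I₂ : D₂ → D₂*`. -/
def T₂₂nat (μ : ℂ) : M.D₂ →L[ℂ] Antidual M.D₂ :=
  M.T₂₂ - μ • (antiadjoint M.I₂).comp M.I₂

/-- The transfer function `S(μ) = T₁₁ - μ I₁* I₁ - T₁₂ (T₂₂ - μ I₂* I₂)⁻¹ T₂₁ : D₁ → D₁*`, for `μ`
in the resolvent set of `T₂₂^•`. -/
def S (μ : ℂ) : M.D₁ →L[ℂ] Antidual M.D₁ :=
  M.T₁₁ - μ • (antiadjoint M.I₁).comp M.I₁ -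
    M.T₁₂.comp ((M.T₂₂nat μ).inverse.comp M.T₂₁)

end SemiboundedOperatorMatrix

end

noncomputable section

/-! ### Resolvent identity -/

/-! The Riesz isomorphism turns operators `D → D*` into bounded operators on `D` (`formOp`). For
real `μ ∈ ϱ(T₂₂^•)` the operator representing `S(μ)` is symmetric and depends on `μ` continuously in
norm. For symmetric operators, being a compact perturbation of a uniformly positive one amounts to
essential positivity: the form dominates `ε ‖x‖²` on a subspace of finite codimension.

Essential positivity is open in norm. It also passes to a norm limit, provided that the limit is
symmetric and bounded below on a subspace of finite codimension (`EssentiallyPositive.of_limit`):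
essential positivity can be lost only when the essential spectrum reaches `0`. It is therefore
constant along an interval on which `S` stays essentially bounded below
(`EssentiallyPositive.of_preconnected`).

It remains to bound `S` below in this sense up to and including `ζ`. Since `S(μ)` is a Schur
complement of `T - μ I* I`, it inherits such a bound (`essentiallyBoundedBelow_formOp_S`). For `μ ∈
ϱ(T^•)` the operator `T - μ I* I` is an isomorphism (`isUnit_shift`, `surjective_T_sub`). At `ζ` the
resolvent of `T^•` at a nearby real point is self-adjoint, and an isolated spectral point with
finite-dimensional kernel leaves a lower bound off that kernel (`essentiallyBoundedBelow_shift`).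
Positivity thus reaches `ζ`, and openness carries it to the other side. The negative case is the
same argument for `-S` in the opposite direction; a real factor `σ = ±1` treats both at once. -/

theorem LinearPMap.IsBoundedInverseAt.sub_eq {E : Type*} [NormedAddCommGroup E] [NormedSpace ℂ E]
    {A : E →ₗ.[ℂ] E} {μ ν : ℂ} {R R' : E →L[ℂ] E} (h : A.IsBoundedInverseAt μ R)
    (h' : A.IsBoundedInverseAt ν R') : R - R' = (μ - ν) • (R' * R) := by
  ext x
  obtain ⟨hx, ex⟩ := h.1 x
  have h1 := h'.2 ⟨R x, hx⟩
  have h2 : A ⟨R x, hx⟩ = x + μ • R x := eq_add_of_sub_eq ex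
  rw [h2] at h1
  change R' (x + μ • R x - ν • R x) = R x at h1
  rw [add_sub_assoc, ← sub_smul, _root_.map_add, _root_.map_smul] at h1
  change R x - R' x = (μ - ν) • R' (R x)
  exact sub_eq_of_eq_add' h1.symm

/-! ### Essential positivity: stability under perturbations and limits -/

namespace EssentialPositivity

variable {E : Type*} [NormedAddCommGroup E] [InnerProductSpace ℂ E]

/-- The quadratic form of `S` is bounded below by a positive constant on a subspace of finite
codimension. -/
def EssentiallyPositive (S : E →L[ℂ] E) : Prop :=
  ∃ F : Submodule ℂ E, FiniteDimensional ℂ F ∧ ∃ ε : ℝ, 0 < ε ∧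
    ∀ x ∈ Fᗮ, ε * ‖x‖ ^ 2 ≤ (⟪x, S x⟫_ℂ).re

/-- The operator `S` is bounded below on a subspace of finite codimension. -/
def EssentiallyBoundedBelow (S : E →L[ℂ] E) : Prop :=
  ∃ F : Submodule ℂ E, FiniteDimensional ℂ F ∧ ∃ c : ℝ, 0 < c ∧ ∀ x ∈ Fᗮ, c * ‖x‖ ≤ ‖S x‖

theorem EssentiallyBoundedBelow.of_bound {S : E →L[ℂ] E} {c : ℝ} (hc : 0 < c)
    (h : ∀ x, c * ‖x‖ ≤ ‖S x‖) : EssentiallyBoundedBelow S :=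
  ⟨⊥, inferInstance, c, hc, fun x _ => h x⟩

theorem abs_re_inner_apply_le (S : E →L[ℂ] E) (x : E) : |(⟪x, S x⟫_ℂ).re| ≤ ‖S‖ * ‖x‖ ^ 2 := by
  calc |(⟪x, S x⟫_ℂ).re| ≤ ‖⟪x, S x⟫_ℂ‖ := Complex.abs_re_le_norm _
    _ ≤ ‖x‖ * ‖S x‖ := norm_inner_le_norm _ _
    _ ≤ ‖x‖ * (‖S‖ * ‖x‖) := by gcongr; exact S.le_opNorm x
    _ = ‖S‖ * ‖x‖ ^ 2 := by ring

theorem re_inner_apply_sub_le (S S' : E →L[ℂ] E) (x : E) :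
    (⟪x, S' x⟫_ℂ).re - ‖S' - S‖ * ‖x‖ ^ 2 ≤ (⟪x, S x⟫_ℂ).re := by
  have h := (abs_le.1 (abs_re_inner_apply_le (S' - S) x)).2
  rw [sub_apply, inner_sub_right, Complex.sub_re] at h
  linarith

/-- A perturbation of norm below `ε / 2` costs at most half of the lower bound, on the same
subspace. -/
theorem EssentiallyPositive.exists_nhds {S : E →L[ℂ] E} (h : EssentiallyPositive S) :
    ∀ᶠ S' in 𝓝 S, EssentiallyPositive S' := by
  obtain ⟨F, hF, ε, hε, hS⟩ := h
  filter_upwards [Metric.ball_mem_nhds S (half_pos hε)] with S' hS'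
  refine ⟨F, hF, ε / 2, half_pos hε, fun x hx => ?_⟩
  have h1 := re_inner_apply_sub_le S' S x
  have h2 : ‖S - S'‖ < ε / 2 := by rwa [← dist_eq_norm, dist_comm]
  have h3 := hS x hx
  nlinarith [sq_nonneg ‖x‖]

/-- A symmetric operator which is essentially bounded below and is a norm limit of essentially
positive operators is essentially positive. -/
theorem EssentiallyPositive.of_limit {S : E →L[ℂ] E} (hsymm : (S : E →ₗ[ℂ] E).IsSymmetric)
    (hS : EssentiallyBoundedBelow S)
    (h : ∀ η > 0, ∃ S' : E →L[ℂ] E, ‖S' - S‖ ≤ η ∧ EssentiallyPositive S') :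
    EssentiallyPositive S := by
  obtain ⟨F₀, hF₀, c, hc, hc'⟩ := hS
  set β : ℝ := ‖S‖ + 1 with hβ
  have hβ0 : 0 < β := by positivity
  -- The three bounds serve, in turn, `‖S + η‖ ≤ β`, the estimate `‖(S + η) x‖ ≥ (c / 2) ‖x‖`, and
  -- the final absorption of `η ‖x‖²`.
  set η : ℝ := min 1 (min (c / 2) (c ^ 2 / (8 * β))) with hη
  have hη0 : 0 < η := by positivity
  have hη1 : η ≤ 1 := min_le_left _ _
  have hη2 : η ≤ c / 2 := (min_le_right _ _).trans (min_le_left _ _)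
  have hη3 : η ≤ c ^ 2 / (8 * β) := (min_le_right _ _).trans (min_le_right _ _)
  obtain ⟨S', hS', F₁, hF₁, ε, hε, hpos⟩ := h η hη0
  -- Orthogonality to `S F₁` forces `S x ∈ F₁ᗮ` by symmetry, so that `x` and `(S + η) x` both lie
  -- where the form of `S + η` is nonnegative.
  refine ⟨F₀ ⊔ (F₁ ⊔ F₁.map (S : E →ₗ[ℂ] E)), inferInstance, c ^ 2 / (8 * β), by positivity,
    fun x hx => ?_⟩
  rw [← Submodule.inf_orthogonal, ← Submodule.inf_orthogonal] at hx
  obtain ⟨hx0, hx1, hx2⟩ := hx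
  have hSx : S x ∈ F₁ᗮ := by
    intro f hf
    have := hx2 (S f) ⟨f, hf, rfl⟩
    rw [← this]
    exact (hsymm f x).symm
  set w := S x + (η : ℂ) • x with hw
  have hwF : w ∈ F₁ᗮ := F₁ᗮ.add_mem hSx (F₁ᗮ.smul_mem _ hx1)
  have hform : ∀ y ∈ F₁ᗮ, -(η * ‖y‖ ^ 2) ≤ (⟪y, S y⟫_ℂ).re := fun y hy => by
    have h1 := re_inner_apply_sub_le S S' y
    have h2 := hpos y hy
    nlinarith [sq_nonneg ‖y‖, mul_nonneg hε.le (sq_nonneg ‖y‖)]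
  -- With `B = S + η` and `w = B x`, nonnegativity of the form of `B` at `x - t w` reads `0 ≤ ⟨x, B
  -- x⟩ - 2 t ‖w‖² + t² ⟨w, B w⟩`. As `⟨w, B w⟩ ≤ β ‖w‖²`, the choice `t = β⁻¹` gives `t ‖w‖² ≤ ⟨x,
  -- B x⟩`.
  set t : ℝ := β⁻¹ with ht
  have ht0 : 0 < t := by positivity
  have key := hform (x - (t : ℂ) • w) (F₁ᗮ.sub_mem hx1 (F₁ᗮ.smul_mem _ hwF))
  have hnorm : ‖x - (t : ℂ) • w‖ ^ 2 = ‖x‖ ^ 2 - 2 * t * (⟪w, x⟫_ℂ).re + t ^ 2 * ‖w‖ ^ 2 := by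
    have h1 : (⟪x, w⟫_ℂ).re = (⟪w, x⟫_ℂ).re := by rw [← inner_conj_symm, Complex.conj_re]
    rw [norm_sub_sq (𝕜 := ℂ), inner_smul_right, norm_smul]
    simp [mul_pow, h1]
    ring
  have hexp : (⟪x - (t : ℂ) • w, S (x - (t : ℂ) • w)⟫_ℂ).re =
      (⟪x, S x⟫_ℂ).re - 2 * t * (⟪w, S x⟫_ℂ).re + t ^ 2 * (⟪w, S w⟫_ℂ).re := by
    have h1 : ⟪x, S w⟫_ℂ = ⟪S x, w⟫_ℂ := (hsymm x w).symm
    have h2 : (⟪S x, w⟫_ℂ).re = (⟪w, S x⟫_ℂ).re := by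
      rw [← inner_conj_symm, Complex.conj_re]
    simp only [map_sub, map_smul, inner_sub_left, inner_sub_right, inner_smul_left,
      inner_smul_right, h1, Complex.conj_ofReal, Complex.sub_re, Complex.re_ofReal_mul, h2]
    ring
  have hww : (⟪w, S x⟫_ℂ).re + η * (⟪w, x⟫_ℂ).re = ‖w‖ ^ 2 := by
    have : ‖w‖ ^ 2 = (⟪w, w⟫_ℂ).re := norm_sq_eq_re_inner (𝕜 := ℂ) w
    rw [this]
    nth_rewrite 4 [hw]
    rw [inner_add_right, inner_smul_right, Complex.add_re, Complex.re_ofReal_mul]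
  have hSw : (⟪w, S w⟫_ℂ).re ≤ (β - η) * ‖w‖ ^ 2 := by
    have := (abs_le.1 (abs_re_inner_apply_le S w)).2
    nlinarith [sq_nonneg ‖w‖]
  have hb : t * ‖w‖ ^ 2 ≤ (⟪x, S x⟫_ℂ).re + η * ‖x‖ ^ 2 := by
    rw [hnorm, hexp] at key
    have h5 : (⟪x, S x⟫_ℂ).re + η * ‖x‖ ^ 2 - 2 * t * ‖w‖ ^ 2 + t ^ 2 * (β * ‖w‖ ^ 2) ≥ 0 := by
      have h6 : t ^ 2 * (⟪w, S w⟫_ℂ).re ≤ t ^ 2 * ((β - η) * ‖w‖ ^ 2) := by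
        refine mul_le_mul_of_nonneg_left ?_ (by positivity)
        linarith
      rw [← hww]
      rw [← hww] at h6 key
      nlinarith
    have h7 : t ^ 2 * (β * ‖w‖ ^ 2) = t * ‖w‖ ^ 2 := by
      rw [ht]; field_simp
    linarith
  have hwx : c / 2 * ‖x‖ ≤ ‖w‖ := by
    have h1 : ‖S x‖ - ‖(η : ℂ) • x‖ ≤ ‖w‖ := by
      simpa [hw] using norm_sub_norm_le (S x) (-((η : ℂ) • x))
    rw [norm_smul, Complex.norm_real, Real.norm_of_nonneg hη0.le] at h1
    have h2 := hc' x hx0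
    nlinarith [norm_nonneg x]
  have hw2 : c ^ 2 / 4 * ‖x‖ ^ 2 ≤ ‖w‖ ^ 2 := by
    have := pow_le_pow_left₀ (by positivity) hwx 2
    calc _ = (c / 2 * ‖x‖) ^ 2 := by ring
      _ ≤ _ := this
  have h8 : t * (c ^ 2 / 4 * ‖x‖ ^ 2) = 2 * (c ^ 2 / (8 * β)) * ‖x‖ ^ 2 := by
    rw [ht]; field_simp; ring
  -- The lower bound `c² / (4 β)` for the form of `S + η` exceeds `η` by at least `c² / (8 β)`.
  nlinarith [mul_le_mul_of_nonneg_left hw2 ht0.le, sq_nonneg ‖x‖]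

/-- Essential positivity propagates along a connected family of symmetric, essentially bounded
below operators. -/
theorem EssentiallyPositive.of_preconnected {X : Type*} [TopologicalSpace X]
    [PreconnectedSpace X] {f : X → E →L[ℂ] E} (hf : Continuous f)
    (hsymm : ∀ t, (f t : E →ₗ[ℂ] E).IsSymmetric) (hb : ∀ t, EssentiallyBoundedBelow (f t))
    {a : X} (ha : EssentiallyPositive (f a)) (b : X) : EssentiallyPositive (f b) := by
  have hopen : IsOpen {t | EssentiallyPositive (f t)} :=
    isOpen_iff_mem_nhds.2 fun t ht => hf.continuousAt.eventually (EssentiallyPositive.exists_nhds ht)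
  have hclosed : IsClosed {t | EssentiallyPositive (f t)} := by
    refine isClosed_of_closure_subset fun t ht => .of_limit (hsymm t) (hb t) fun η hη => ?_
    obtain ⟨s, hs, hs'⟩ := mem_closure_iff_nhds.1 ht _
      (hf.continuousAt.preimage_mem_nhds (Metric.ball_mem_nhds (f t) hη))
    exact ⟨f s, by rw [← dist_eq_norm]; exact (Metric.mem_ball.1 hs).le, hs'⟩
  have := IsClopen.eq_univ ⟨hclosed, hopen⟩ ⟨a, ha⟩
  exact Set.eq_univ_iff_forall.1 this b

/-! ### Essential positivity and compact perturbations -/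

variable [CompleteSpace E]

/-- A compact operator is small on a subspace of finite codimension. -/
theorem exists_norm_apply_le_of_isCompactOperator {K : E →L[ℂ] E} (hK : IsCompactOperator K)
    {ε : ℝ} (hε : 0 < ε) : ∃ F : Submodule ℂ E, FiniteDimensional ℂ F ∧
      ∀ x ∈ Fᗮ, ‖K x‖ ≤ ε * ‖x‖ := by
  have hc : IsCompact (closure (K '' Metric.closedBall 0 1)) :=
    IsCompactOperator.isCompact_closure_image_closedBall (f := (K : E →ₗ[ℂ] E)) hK 1
  obtain ⟨t, htf, ht⟩ := Metric.totallyBounded_iff.1 hc.totallyBounded ε hε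
  -- Here `t` is a finite `ε`-net of the image of the unit ball. If `x` is orthogonal to `K* t`,
  -- then `K x` is orthogonal to the net, yet for a unit vector it lies within `ε` of a point of it.
  refine ⟨Submodule.span ℂ (K.adjoint '' t), FiniteDimensional.span_of_finite ℂ (htf.image _),
    fun x hx => ?_⟩
  rcases eq_or_ne x 0 with rfl | hx0
  · simp
  have hn : 0 < ‖x‖ := norm_pos_iff.2 hx0
  set u : E := ((‖x‖⁻¹ : ℝ) : ℂ) • x with hu
  have hun : ‖u‖ = 1 := by
    rw [hu, norm_smul, Complex.norm_real, Real.norm_of_nonneg (by positivity),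
      inv_mul_cancel₀ hn.ne']
  have hmem : K u ∈ closure (K '' Metric.closedBall 0 1) :=
    subset_closure ⟨u, by simp [hun], rfl⟩
  obtain ⟨y, hy, hyu⟩ := Set.mem_iUnion₂.1 (ht hmem)
  have horth : ⟪y, K u⟫_ℂ = 0 := by
    rw [hu, map_smul, inner_smul_right, ← ContinuousLinearMap.adjoint_inner_left,
      hx _ (Submodule.subset_span ⟨y, hy, rfl⟩), mul_zero]
  have hKu : ‖K u‖ ≤ ε := by
    have h1 : ‖K u‖ ^ 2 = (⟪K u - y, K u⟫_ℂ).re := by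
      rw [inner_sub_left, horth, sub_zero]
      exact norm_sq_eq_re_inner (𝕜 := ℂ) _
    have h2 : (⟪K u - y, K u⟫_ℂ).re ≤ ‖K u - y‖ * ‖K u‖ :=
      (Complex.re_le_norm _).trans (norm_inner_le_norm _ _)
    have h3 : ‖K u - y‖ < ε := by rwa [← dist_eq_norm]
    by_contra! hlt
    nlinarith [norm_nonneg (K u)]
  have hxu : x = ((‖x‖ : ℝ) : ℂ) • u := by
    rw [hu, smul_smul, ← Complex.ofReal_mul, mul_inv_cancel₀ hn.ne', Complex.ofReal_one, one_smul]
  calc ‖K x‖ = ‖x‖ * ‖K u‖ := by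
        nth_rewrite 1 [hxu]
        rw [map_smul, norm_smul, Complex.norm_real, Real.norm_of_nonneg hn.le]
    _ ≤ ε * ‖x‖ := by rw [mul_comm]; gcongr

/-- Off a finite-dimensional space the norm of `K` is at most `ε / 2`, which leaves half of the
lower bound of `A`. -/
theorem EssentiallyPositive.of_compact_perturbation {A K : E →L[ℂ] E} {ε : ℝ} (hε : 0 < ε)
    (hA : ∀ x, ε * ‖x‖ ^ 2 ≤ (⟪x, A x⟫_ℂ).re) (hK : IsCompactOperator K) :
    EssentiallyPositive (A + K) := by
  obtain ⟨F, hF, h⟩ := exists_norm_apply_le_of_isCompactOperator hK (half_pos hε)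
  refine ⟨F, hF, ε / 2, half_pos hε, fun x hx => ?_⟩
  have h1 : -(‖x‖ * ‖K x‖) ≤ (⟪x, K x⟫_ℂ).re :=
    neg_le_of_abs_le ((Complex.abs_re_le_norm _).trans (norm_inner_le_norm _ _))
  have h2 := h x hx
  have h3 := hA x
  rw [add_apply, inner_add_right, Complex.add_re]
  nlinarith [norm_nonneg x]

/-- A symmetric essentially positive operator is a compact perturbation of a uniformly positive
symmetric one. -/
theorem EssentiallyPositive.exists_compact_perturbation {S : E →L[ℂ] E}
    (hsymm : (S : E →ₗ[ℂ] E).IsSymmetric) (h : EssentiallyPositive S) :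
    ∃ (A : E →L[ℂ] E) (ε : ℝ), 0 < ε ∧ (A : E →ₗ[ℂ] E).IsSymmetric ∧
      (∀ x, ε * ‖x‖ ^ 2 ≤ (⟪x, A x⟫_ℂ).re) ∧ IsCompactOperator (S - A) := by
  obtain ⟨F, hF, ε, hε, hS⟩ := h
  set Q : E →L[ℂ] E := F.starProjection with hQ
  have hQs : ∀ x y, ⟪Q x, y⟫_ℂ = ⟪x, Q y⟫_ℂ := fun x y => F.inner_starProjection_left_eq_right x y
  have hQF : ∀ x, Q x ∈ F := fun x => F.starProjection_apply_mem x
  have hPF : ∀ x, x - Q x ∈ Fᗮ := fun x => F.sub_starProjection_mem_orthogonal x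
  have hQc : IsCompactOperator Q := by
    have h1 : IsCompactOperator F.orthogonalProjectionOnto :=
      isCompactOperator_of_locallyCompactSpace_dom F.orthogonalProjectionOnto
    exact h1.clm_comp F.subtypeL
  have hQQ : ∀ x, Q (Q x) = Q x := fun x => F.starProjection_eq_self_iff.2 (hQF x)
  -- Compress `S` to `Fᗮ`, where it is positive, and put the constant `ε` on `F`; every term of the
  -- difference from `S` contains the finite-rank projection `Q`.
  refine ⟨(1 - Q) * S * (1 - Q) + (ε : ℂ) • Q, ε, hε, ?_, ?_, ?_⟩
  · intro x y
    have hs : ∀ x y, ⟪S x, y⟫_ℂ = ⟪x, S y⟫_ℂ := hsymm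
    have hε' : ⟪(ε : ℂ) • Q x, y⟫_ℂ = ⟪x, (ε : ℂ) • Q y⟫_ℂ := by
      rw [inner_smul_left, inner_smul_right, Complex.conj_ofReal, hQs]
    change ⟪S (x - Q x) - Q (S (x - Q x)) + (ε : ℂ) • Q x, y⟫_ℂ =
      ⟪x, S (y - Q y) - Q (S (y - Q y)) + (ε : ℂ) • Q y⟫_ℂ
    simp only [inner_add_left, inner_add_right, inner_sub_left, inner_sub_right, map_sub, hQs, hs,
      hε']
    ring
  · intro x
    have h1 : ⟪x, ((1 - Q) * S * (1 - Q) + (ε : ℂ) • Q) x⟫_ℂ =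
        ⟪x - Q x, S (x - Q x)⟫_ℂ + (ε : ℂ) * ⟪Q x, Q x⟫_ℂ := by
      simp only [add_apply, smul_apply, mul_apply_eq_comp, sub_apply,
        one_apply_eq_self, inner_add_right, inner_smul_right]
      rw [hQs, hQQ, inner_sub_left, hQs, ← inner_sub_right]
    rw [h1, Complex.add_re, Complex.re_ofReal_mul]
    have h2 := hS _ (hPF x)
    have h3 : (⟪Q x, Q x⟫_ℂ).re = ‖Q x‖ ^ 2 := (norm_sq_eq_re_inner (𝕜 := ℂ) (Q x)).symm
    have h4 : ‖x‖ ^ 2 = ‖Q x‖ ^ 2 + ‖x - Q x‖ ^ 2 := by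
      have := norm_add_sq_eq_norm_sq_add_norm_sq_of_inner_eq_zero (𝕜 := ℂ) (Q x) (x - Q x)
        (hPF x _ (hQF x))
      rw [add_sub_cancel] at this
      nlinarith
    rw [h3, h4]
    nlinarith
  · have : S - ((1 - Q) * S * (1 - Q) + (ε : ℂ) • Q) = Q * S * (1 - Q) + S * Q - (ε : ℂ) • Q := by
      noncomm_ring
    rw [this]
    have h1 : IsCompactOperator (Q * S * (1 - Q) : E →L[ℂ] E) := by
      rw [mul_assoc]
      exact hQc.comp_clm (S * (1 - Q))
    have h2 : IsCompactOperator (S * Q : E →L[ℂ] E) := hQc.clm_comp S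
    have h3 : IsCompactOperator ((ε : ℂ) • Q : E →L[ℂ] E) := hQc.smul (ε : ℂ)
    exact IsCompactOperator.sub (f := ⇑(Q * S * (1 - Q) + S * Q : E →L[ℂ] E))
      (IsCompactOperator.add h1 h2) h3

/-- If `0` is isolated in the spectrum of a self-adjoint operator `L`, then `L` has a bounded
generalized inverse. -/
theorem exists_mul_mul_eq_self {L : E →L[ℂ] E} (hL : IsSelfAdjoint L)
    (h : ∀ᶠ t : ℝ in 𝓝[≠] 0, IsUnit (algebraMap ℝ (E →L[ℂ] E) t - L)) :
    ∃ G : E →L[ℂ] E, L * G * L = L := by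
  have hcont : ContinuousOn (fun x : ℝ => x⁻¹) (spectrum ℝ L) := by
    intro x hx
    rcases eq_or_ne x 0 with rfl | hx0
    -- Inversion is continuous at `0` relative to the spectrum, because `0` is an isolated point of
    -- it or not in it at all.
    · have h1 : 𝓝[spectrum ℝ L] (0 : ℝ) ≤ pure 0 := by
        rw [eventually_nhdsWithin_iff] at h
        intro s hs
        rw [mem_pure] at hs
        filter_upwards [self_mem_nhdsWithin, nhdsWithin_le_nhds h] with y hy hy'
        by_cases hy0 : y = 0
        · rwa [hy0]
        · exact absurd (hy' hy0) hy
      exact (tendsto_pure_nhds _ _).mono_left h1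
    · exact (continuousAt_inv₀ hx0).continuousWithinAt
  refine ⟨cfc (fun x : ℝ => x⁻¹) L, ?_⟩
  nth_rewrite 1 [← cfc_id' ℝ L]
  rw [← cfc_mul (fun x : ℝ => x) (fun x : ℝ => x⁻¹) L (by fun_prop) hcont]
  nth_rewrite 2 [← cfc_id' ℝ L]
  rw [← cfc_mul (fun x : ℝ => x * x⁻¹) (fun x : ℝ => x) L (continuousOn_id.mul hcont) (by fun_prop)]
  nth_rewrite 2 [← cfc_id' ℝ L]
  -- The convention `0⁻¹ = 0` makes `x * x⁻¹ * x = x` valid at `0` too.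
  exact cfc_congr fun x _ => mul_inv_mul_cancel x

/-- If `L G L = L`, then `x - G (L x)` lies in the kernel. For `x` orthogonal to the kernel this
yields `‖x‖² = ⟨G (L x), x⟩`, and `c = ‖G‖` works. -/
theorem exists_bound_of_isolated {L : E →L[ℂ] E} (hL : IsSelfAdjoint L)
    (h : ∀ᶠ t : ℝ in 𝓝[≠] 0, IsUnit (algebraMap ℝ (E →L[ℂ] E) t - L)) :
    ∃ c : ℝ, 0 ≤ c ∧ ∀ x ∈ (L : E →ₗ[ℂ] E).kerᗮ, ‖x‖ ≤ c * ‖L x‖ := by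
  obtain ⟨G, hG⟩ := exists_mul_mul_eq_self hL h
  refine ⟨‖G‖, norm_nonneg _, fun x hx => ?_⟩
  have hker : x - G (L x) ∈ (L : E →ₗ[ℂ] E).ker := by
    have := congrArg (fun f : E →L[ℂ] E => f x) hG
    simp only [mul_apply_eq_comp] at this
    simp [LinearMap.mem_ker, this]
  have h1 := hx _ hker
  rw [inner_sub_left, sub_eq_zero] at h1
  have h2 : ‖x‖ ^ 2 ≤ ‖G (L x)‖ * ‖x‖ := by
    have : ‖x‖ ^ 2 = ‖⟪x, x⟫_ℂ‖ := by rw [inner_self_eq_norm_sq_to_K]; simp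
    rw [this, h1]
    exact norm_inner_le_norm _ _
  have h3 := G.le_opNorm (L x)
  rcases (norm_nonneg x).eq_or_lt with h0 | h0
  · rw [← h0]; positivity
  · nlinarith

end EssentialPositivity

namespace Rigging

open EssentialPositivity

variable {D H : Type*} [NormedAddCommGroup D] [InnerProductSpace ℂ D] [CompleteSpace D]
  [NormedAddCommGroup H] [InnerProductSpace ℂ H] [CompleteSpace H]

/-! ### The Riesz isomorphism `D → D*` -/

variable (D) in
/-- The Riesz isomorphism of `D` onto the space of bounded conjugate-linear functionals. -/
def riesz : D ≃L[ℂ] Antidual D :=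
  ContinuousLinearEquiv.ofBijective (innerSLFlip ℂ : D →L[ℂ] Antidual D)
    (LinearMap.ker_eq_bot'.2 fun x hx => by
      have := congrArg (fun f : Antidual D => f x) hx
      simpa using this)
    (LinearMap.range_eq_top.2 fun f => by
      let g : D →L[ℂ] ℂ := (starL ℂ : ℂ ≃L⋆[ℂ] ℂ).toContinuousLinearMap.comp f
      refine ⟨(InnerProductSpace.toDual ℂ D).symm g, ?_⟩
      ext z
      have h : ⟪(InnerProductSpace.toDual ℂ D).symm g, z⟫_ℂ = g z :=
        InnerProductSpace.toDual_symm_apply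
      have h2 : ⟪z, (InnerProductSpace.toDual ℂ D).symm g⟫_ℂ = f z := by
        rw [← inner_conj_symm, h]
        exact Complex.conj_conj _
      exact h2)

@[simp]
theorem riesz_apply (x z : D) : riesz D x z = ⟪z, x⟫_ℂ := rfl

/-- The operator in `D` which represents the sesquilinear form of `T : D → D*`. -/
def formOp (T : D →L[ℂ] Antidual D) : D →L[ℂ] D :=
  ((riesz D).symm : Antidual D →L[ℂ] D).comp T

theorem riesz_formOp (T : D →L[ℂ] Antidual D) (y : D) : riesz D (formOp T y) = T y :=
  (riesz D).apply_symm_apply (T y)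

theorem inner_formOp (T : D →L[ℂ] Antidual D) (y z : D) : ⟪z, formOp T y⟫_ℂ = T y z := by
  rw [← riesz_apply, riesz_formOp]

theorem formOp_eq {T : D →L[ℂ] Antidual D} {A : D →L[ℂ] D} (h : ∀ y z, ⟪z, A y⟫_ℂ = T y z) :
    formOp T = A :=
  ContinuousLinearMap.ext fun y => ext_inner_left ℂ fun z => by rw [inner_formOp, h]

theorem formOp_neg (T : D →L[ℂ] Antidual D) : formOp (-T) = -formOp T :=
  formOp_eq fun y z => by simp [inner_formOp]

theorem formOp_add (S T : D →L[ℂ] Antidual D) : formOp (S + T) = formOp S + formOp T :=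
  formOp_eq fun y z => by simp [inner_formOp]

theorem essentiallyPositive_formOp {S : D →L[ℂ] Antidual D}
    (h : IsCompactPerturbationOfUniformlyPositive S) : EssentiallyPositive (formOp S) := by
  obtain ⟨A, K, ⟨ε, hε, hA⟩, hK, rfl⟩ := h
  rw [formOp_add]
  refine .of_compact_perturbation hε (fun x => ?_)
    (hK.clm_comp ((riesz D).symm : Antidual D →L[ℂ] D))
  rw [inner_formOp]
  exact (hA x).2

/-- Symmetry is needed because uniform positivity includes that the form is real. -/
theorem isCompactPerturbation_of_essentiallyPositive {S : D →L[ℂ] Antidual D}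
    (hsymm : (formOp S : D →ₗ[ℂ] D).IsSymmetric) (h : EssentiallyPositive (formOp S)) :
    IsCompactPerturbationOfUniformlyPositive S := by
  obtain ⟨A, ε, hε, hA, hpos, hK⟩ := h.exists_compact_perturbation hsymm
  refine ⟨(riesz D : D →L[ℂ] Antidual D).comp A,
    (riesz D : D →L[ℂ] Antidual D).comp (formOp S - A), ⟨ε, hε, fun y => ⟨?_, hpos y⟩⟩,
    hK.clm_comp (riesz D : D →L[ℂ] Antidual D), ?_⟩
  · refine Complex.conj_eq_iff_im.1 ?_
    change (starRingEnd ℂ) ⟪y, A y⟫_ℂ = ⟪y, A y⟫_ℂ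
    rw [inner_conj_symm]
    exact hA y y
  · ext1 y
    change S y = riesz D (A y) + riesz D (formOp S y - A y)
    rw [← map_add, add_sub_cancel, riesz_formOp]

theorem isCompactPerturbationOfUniformlyNegative_iff {S : D →L[ℂ] Antidual D} :
    IsCompactPerturbationOfUniformlyNegative S ↔ IsCompactPerturbationOfUniformlyPositive (-S) := by
  constructor
  · rintro ⟨A, K, hA, hK, rfl⟩
    exact ⟨-A, -K, hA, hK.neg, by abel⟩
  · rintro ⟨A, K, hA, hK, h⟩
    have hA' : -(-A) = A := by ext; simp
    refine ⟨-A, -K, (congrArg UniformlyPositive hA').mpr hA, hK.neg, ?_⟩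
    ext y z
    have := congrArg (fun f : D →L[ℂ] Antidual D => f y z) h
    simp only [neg_apply, add_apply] at this ⊢
    linear_combination -this

/-! ### The resolvent set of `T^•` -/

/-- The operator in `D` which represents `T - μ I* I`. -/
def shift (I : D →L[ℂ] H) (T : D →L[ℂ] Antidual D) (μ : ℂ) : D →L[ℂ] D :=
  formOp T - μ • I.adjoint.comp I

theorem shift_apply (I : D →L[ℂ] H) (T : D →L[ℂ] Antidual D) (μ : ℂ) (x : D) :
    shift I T μ x = formOp T x - μ • I.adjoint (I x) := rfl

theorem apply_eq_antiadjoint_iff {I : D →L[ℂ] H} {T : D →L[ℂ] Antidual D} {y : D} {h : H} :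
    T y = antiadjoint I h ↔ formOp T y = I.adjoint h := by
  rw [← riesz_formOp, ← (riesz D).injective.eq_iff]
  have : riesz D (I.adjoint h) = antiadjoint I h := by
    ext z
    simp [ContinuousLinearMap.adjoint_inner_right]
  rw [this]

theorem apply_eq_antiadjoint_add_iff {I : D →L[ℂ] H} {T : D →L[ℂ] Antidual D} {y : D} {h : H}
    {μ : ℂ} : T y = antiadjoint I (h + μ • I y) ↔ shift I T μ y = I.adjoint h := by
  rw [apply_eq_antiadjoint_iff, shift_apply, map_add, map_smul, sub_eq_iff_eq_add]

/-- This moves resolvents of the unbounded `T^•` to equations in `D` with right-hand sides in the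
range of `I*`, and so removes all reference to domains. -/
theorem isBoundedInverseAt_bullet_iff {I : D →L[ℂ] H} (hI : Function.Injective I)
    (hd : DenseRange I) {T : D →L[ℂ] Antidual D} {μ : ℂ} {R : H →L[ℂ] H} :
    (bullet I T).IsBoundedInverseAt μ R ↔
      (∀ h, ∃ x, I x = R h ∧ shift I T μ x = I.adjoint h) ∧
        ∀ x h, shift I T μ x = I.adjoint h → R h = I x := by
  constructor
  · rintro ⟨h1, h2⟩
    refine ⟨fun h => ?_, fun x h hx => ?_⟩
    · obtain ⟨hm, he⟩ := h1 h
      have hg := (bullet I T).mem_graph ⟨R h, hm⟩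
      rw [bullet_graph hI hd] at hg
      obtain ⟨y, hy1, hy2⟩ := hg
      simp only at hy1 hy2
      refine ⟨y, hy1, apply_eq_antiadjoint_add_iff.1 ?_⟩
      rw [hy2, hy1, eq_add_of_sub_eq he]
    · have hg : (I x, h + μ • I x) ∈ (bullet I T).graph := by
        rw [bullet_graph hI hd]
        exact ⟨x, rfl, apply_eq_antiadjoint_add_iff.2 hx⟩
      obtain ⟨y, hy1, hy2⟩ := (LinearPMap.mem_graph_iff _).1 hg
      simp only at hy1 hy2
      have := h2 y
      rwa [hy1, hy2, add_sub_cancel_right] at this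
  · rintro ⟨h1, h2⟩
    refine ⟨fun h => ?_, fun x => ?_⟩
    · obtain ⟨y, hy1, hy2⟩ := h1 h
      have hg : (R h, h + μ • R h) ∈ (bullet I T).graph := by
        rw [bullet_graph hI hd, ← hy1]
        exact ⟨y, rfl, apply_eq_antiadjoint_add_iff.2 hy2⟩
      obtain ⟨z, hz1, hz2⟩ := (LinearPMap.mem_graph_iff _).1 hg
      simp only at hz1 hz2
      have hm : R h ∈ (bullet I T).domain := hz1 ▸ z.2
      refine ⟨hm, ?_⟩
      have hz : z = ⟨R h, hm⟩ := Subtype.ext hz1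
      rw [← hz, hz2, add_sub_cancel_right]
    · have hg := (bullet I T).mem_graph x
      rw [bullet_graph hI hd] at hg
      obtain ⟨y, hy1, hy2⟩ := hg
      simp only at hy1 hy2
      rw [← hy1]
      refine h2 y _ (apply_eq_antiadjoint_add_iff.1 ?_)
      rw [hy2, sub_add_cancel]

theorem mem_resolventSet_of_isUnit {I : D →L[ℂ] H} (hI : Function.Injective I)
    (hd : DenseRange I) {T : D →L[ℂ] Antidual D} {μ : ℂ} (h : IsUnit (shift I T μ)) :
    μ ∈ (bullet I T).resolventSet := by
  obtain ⟨Y, hY1, hY2⟩ := isUnit_iff_exists.1 h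
  have hY1' : ∀ x, shift I T μ (Y x) = x := fun x => congrArg (fun f : D →L[ℂ] D => f x) hY1
  have hY2' : ∀ x, Y (shift I T μ x) = x := fun x => congrArg (fun f : D →L[ℂ] D => f x) hY2
  refine ⟨I.comp (Y.comp I.adjoint), (isBoundedInverseAt_bullet_iff hI hd).2
    ⟨fun h => ⟨Y (I.adjoint h), rfl, hY1' _⟩, fun x h hx => ?_⟩⟩
  change I (Y (I.adjoint h)) = I x
  rw [← hx, hY2']

/-- If `T` becomes an isomorphism after a perturbation by a bounded operator in `H`, then
`T - μ I* I` is an isomorphism for all `μ` in the resolvent set of `T^•`. -/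
theorem isUnit_shift {I : D →L[ℂ] H} (hI : Function.Injective I) (hd : DenseRange I)
    {T : D →L[ℂ] Antidual D} {C : H →L[ℂ] H}
    (hC : Function.Surjective (formOp T - I.adjoint.comp (C.comp I))) {μ : ℂ}
    (h : μ ∈ (bullet I T).resolventSet) : IsUnit (shift I T μ) := by
  obtain ⟨R, hR⟩ := h
  obtain ⟨h1, h2⟩ := (isBoundedInverseAt_bullet_iff hI hd).1 hR
  rw [ContinuousLinearMap.isUnit_iff_bijective]
  constructor
  · rw [injective_iff_map_eq_zero]
    intro y hy
    have := h2 y 0 (by rw [hy, map_zero])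
    exact hI (by rw [← this, map_zero, map_zero])
  · intro u
    obtain ⟨g, hg⟩ := hC u
    -- The resolvent solves only equations with right-hand side in the range of `I*`. The vector `g`
    -- solves the perturbed equation for an arbitrary `u`, with an error in that range, which `x`
    -- then corrects.
    obtain ⟨x, -, hx⟩ := h1 (C (I g) - μ • I g)
    refine ⟨g - x, ?_⟩
    rw [map_sub, hx, ← hg, shift_apply, map_sub, map_smul]
    change formOp T g - μ • I.adjoint (I g) - (I.adjoint (C (I g)) - μ • I.adjoint (I g)) =
      formOp T g - I.adjoint (C (I g))
    abel

theorem isSymmetric_shift {I : D →L[ℂ] H} {T : D →L[ℂ] Antidual D}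
    (hT : (formOp T : D →ₗ[ℂ] D).IsSymmetric) (μ : ℝ) :
    (shift I T μ : D →ₗ[ℂ] D).IsSymmetric := by
  intro x y
  have h : ⟪formOp T x, y⟫_ℂ = ⟪x, formOp T y⟫_ℂ := hT x y
  change ⟪shift I T μ x, y⟫_ℂ = ⟪x, shift I T μ y⟫_ℂ
  rw [shift_apply, shift_apply, inner_sub_left, inner_sub_right, inner_smul_left,
    inner_smul_right, h, Complex.conj_ofReal, ContinuousLinearMap.adjoint_inner_left,
    ContinuousLinearMap.adjoint_inner_right]

theorem isSelfAdjoint_resolvent {I : D →L[ℂ] H} (hI : Function.Injective I) (hd : DenseRange I)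
    {T : D →L[ℂ] Antidual D} (hT : (formOp T : D →ₗ[ℂ] D).IsSymmetric) {μ : ℝ} {R : H →L[ℂ] H}
    (hR : (bullet I T).IsBoundedInverseAt μ R) : IsSelfAdjoint R := by
  rw [ContinuousLinearMap.isSelfAdjoint_iff_isSymmetric]
  intro h k
  obtain ⟨h1, -⟩ := (isBoundedInverseAt_bullet_iff hI hd).1 hR
  obtain ⟨x, hx1, hx2⟩ := h1 h
  obtain ⟨y, hy1, hy2⟩ := h1 k
  change ⟪R h, k⟫_ℂ = ⟪h, R k⟫_ℂ
  have e1 : ⟪I x, k⟫_ℂ = ⟪x, shift I T μ y⟫_ℂ := by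
    rw [hy2, ContinuousLinearMap.adjoint_inner_right]
  have e2 : ⟪h, I y⟫_ℂ = ⟪shift I T μ x, y⟫_ℂ := by
    rw [hx2, ContinuousLinearMap.adjoint_inner_left]
  rw [← hx1, ← hy1, e1, e2]
  exact (isSymmetric_shift hT μ x y).symm

/-! ### Lower bounds at an isolated eigenvalue -/

theorem exists_bound_of_isUnit {A : D →L[ℂ] D} (hA : IsUnit A) :
    ∃ c : ℝ, 0 < c ∧ ∀ x, c * ‖x‖ ≤ ‖A x‖ := by
  obtain ⟨Y, -, hY⟩ := isUnit_iff_exists.1 hA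
  refine ⟨(‖Y‖ + 1)⁻¹, by positivity, fun x => ?_⟩
  have h1 : Y (A x) = x := congrArg (fun f : D →L[ℂ] D => f x) hY
  have h2 := Y.le_opNorm (A x)
  rw [h1] at h2
  rw [inv_mul_le_iff₀ (by positivity)]
  nlinarith [norm_nonneg (A x)]

theorem tendsto_ofReal_nhdsNE (ζ : ℝ) : Tendsto (fun t : ℝ => (t : ℂ)) (𝓝[≠] ζ) (𝓝[≠] (ζ : ℂ)) :=
  tendsto_nhdsWithin_of_tendsto_nhds_of_eventually_within _
    (Complex.continuous_ofReal.continuousAt.tendsto.mono_left nhdsWithin_le_nhds)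
    (eventually_nhdsWithin_of_forall fun t ht => by simpa using ht)

/-- If `ζ` is isolated in the spectrum of `A` and `R = (A - μ)⁻¹`, then `0` is isolated in the
spectrum of `1 - (ζ - μ) R`. -/
theorem eventually_isUnit_of_isolated {A : H →ₗ.[ℂ] H} {ζ μ : ℝ} (hμ : ζ - μ ≠ 0)
    (h : ∀ᶠ ν in 𝓝[≠] (ζ : ℂ), ν ∈ A.resolventSet) {R : H →L[ℂ] H}
    (hR : A.IsBoundedInverseAt μ R) :
    ∀ᶠ t : ℝ in 𝓝[≠] 0, IsUnit (algebraMap ℝ (H →L[ℂ] H) t - (1 - ((ζ - μ : ℝ) : ℂ) • R)) := by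
  -- Spectral mapping: `t - (1 - (ζ - μ) R) = (t - 1)(1 - e R)` with `e = (ζ - μ) / (1 - t)`, and
  -- the point `μ + e` tends to `ζ` without equalling it for `t ≠ 0`.
  have hlim : Tendsto (fun t : ℝ => μ + (ζ - μ) / (1 - t)) (𝓝[≠] 0) (𝓝[≠] ζ) := by
    refine tendsto_nhdsWithin_of_tendsto_nhds_of_eventually_within _ ?_ ?_
    · have : ContinuousAt (fun t : ℝ => μ + (ζ - μ) / (1 - t)) 0 :=
        continuousAt_const.add (continuousAt_const.div (by fun_prop) (by norm_num))
      have h0 := this.tendsto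
      simp only [sub_zero, div_one, add_sub_cancel] at h0
      exact h0.mono_left nhdsWithin_le_nhds
    · filter_upwards [self_mem_nhdsWithin,
        nhdsWithin_le_nhds (Iio_mem_nhds (zero_lt_one (α := ℝ)))] with t ht ht1 heq
      have h1 : (1 - t) ≠ 0 := by
        have : t < 1 := ht1
        linarith
      have h2 : (ζ - μ) / (1 - t) = ζ - μ := by
        have heq' : μ + (ζ - μ) / (1 - t) = ζ := heq
        linarith
      rw [div_eq_iff h1] at h2
      have h3 : (ζ - μ) * t = 0 := by linarith
      exact ht ((mul_eq_zero.1 h3).resolve_left hμ)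
  filter_upwards [(tendsto_ofReal_nhdsNE ζ).comp hlim |>.eventually h,
    nhdsWithin_le_nhds (Iio_mem_nhds (zero_lt_one (α := ℝ)))] with t ht ht1
  have h1 : (1 - t) ≠ 0 := by
    have : t < 1 := ht1
    linarith
  obtain ⟨R', hR'⟩ := ht
  set e : ℝ := (ζ - μ) / (1 - t) with he
  simp only [Function.comp_apply] at hR'
  have e1 := hR.sub_eq hR'
  have e2 := hR'.sub_eq hR
  rw [Complex.ofReal_add] at e1 e2
  rw [sub_add_cancel_left, ← neg_sub, neg_smul, neg_inj] at e1
  rw [add_sub_cancel_left] at e2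
  -- By the resolvent identity, taken in both orders, the inverse is `1 + e R'` with `R' = (A - (μ +
  -- e))⁻¹`.
  have hu : IsUnit (1 - (e : ℂ) • R) := by
    refine isUnit_iff_exists.2 ⟨1 + (e : ℂ) • R', ?_, ?_⟩
    · have : (1 - (e : ℂ) • R) * (1 + (e : ℂ) • R') =
          1 + (e : ℂ) • ((R' - R) - (e : ℂ) • (R * R')) := by
        simp only [sub_mul, mul_add, one_mul, mul_one, smul_mul_assoc, mul_smul_comm, smul_sub]
        abel
      rw [this, e2, sub_self, smul_zero, add_zero]
    · have : (1 + (e : ℂ) • R') * (1 - (e : ℂ) • R) =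
          1 + (e : ℂ) • ((R' - R) - (e : ℂ) • (R' * R)) := by
        simp only [mul_sub, add_mul, one_mul, mul_one, smul_mul_assoc, mul_smul_comm, smul_sub,
          smul_add]
        abel
      rw [this, e1, sub_self, smul_zero, add_zero]
  have heq : algebraMap ℝ (H →L[ℂ] H) t - (1 - ((ζ - μ : ℝ) : ℂ) • R) =
      algebraMap ℂ (H →L[ℂ] H) ((t - 1 : ℝ) : ℂ) * (1 - (e : ℂ) • R) := by
    have h2 : ((ζ - μ : ℝ) : ℂ) = -(((t - 1 : ℝ) : ℂ) * (e : ℂ)) := by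
      rw [← Complex.ofReal_mul, ← Complex.ofReal_neg, he]
      congr 1
      field_simp
      ring
    rw [h2, ← Algebra.smul_def, smul_sub, smul_smul, neg_smul, Complex.ofReal_sub,
      Complex.ofReal_one]
    ext x
    simp [Algebra.algebraMap_eq_smul_one, sub_smul]
    abel
  rw [heq]
  refine IsUnit.mul (IsUnit.map _ (isUnit_iff_ne_zero.2 ?_)) hu
  rw [Complex.ofReal_ne_zero]
  intro h0
  exact h1 (by linarith)

/-- If `ζ` is an isolated eigenvalue of finite multiplicity of the self-adjoint operator `T^•`,
then `T - ζ I* I` is essentially bounded below. -/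
theorem essentiallyBoundedBelow_shift {I : D →L[ℂ] H} (hI : Function.Injective I)
    (hd : DenseRange I) {T : D →L[ℂ] Antidual D} (hT : (formOp T : D →ₗ[ℂ] D).IsSymmetric)
    {C : H →L[ℂ] H} (hC : Function.Surjective (formOp T - I.adjoint.comp (C.comp I))) {ζ : ℝ}
    (hζ : (bullet I T).IsIsolatedEigenvalueOfFiniteMultiplicity (ζ : ℂ)) :
    EssentiallyBoundedBelow (shift I T ζ) := by
  obtain ⟨-, hfin, hiso⟩ := hζ
  obtain ⟨μ, hμ, hμζ⟩ :=
    (((tendsto_ofReal_nhdsNE ζ).eventually hiso).and self_mem_nhdsWithin).exists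
  have hd0 : ζ - μ ≠ 0 := sub_ne_zero.2 (Ne.symm hμζ)
  obtain ⟨Y, -, hY⟩ := isUnit_iff_exists.1 (isUnit_shift hI hd hC hμ)
  have hY' : ∀ x, Y (shift I T μ x) = x := fun x => congrArg (fun f : D →L[ℂ] D => f x) hY
  obtain ⟨R, hR⟩ := hμ
  set d : ℂ := ((ζ - μ : ℝ) : ℂ) with hd'
  have hdμ : d + (μ : ℂ) = ζ := by rw [hd']; push_cast; ring
  set L : H →L[ℂ] H := 1 - d • R with hL
  have hLs : IsSelfAdjoint L := by
    refine (IsSelfAdjoint.one _).sub (IsSelfAdjoint.smul ?_ (isSelfAdjoint_resolvent hI hd hT hR))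
    exact Complex.conj_ofReal _
  obtain ⟨c, hc, hbound⟩ := exists_bound_of_isolated hLs (eventually_isUnit_of_isolated hd0 hiso hR)
  -- From `w = d R w` follows `A R w = w + μ R w = (d + μ) R w = ζ R w`.
  have hker : (L : H →ₗ[ℂ] H).ker ≤ (bullet I T).eigenspaceAt ζ := by
    intro w hw
    have hw' : w = d • R w := by
      have : w - d • R w = 0 := hw
      exact sub_eq_zero.1 this
    rw [hw']
    refine Submodule.smul_mem _ _ ?_
    obtain ⟨hm, he⟩ := hR.1 w
    refine ⟨hm, ?_⟩
    rw [eq_add_of_sub_eq he, ← hdμ, add_smul, ← hw']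
  have hfk : FiniteDimensional ℂ (L : H →ₗ[ℂ] H).ker :=
    Submodule.finiteDimensional_of_le hker
  have hkey : ∀ y : D, y = Y (shift I T ζ y) + d • Y (I.adjoint (I y)) := fun y => by
    have : shift I T μ y = shift I T ζ y + d • I.adjoint (I y) := by
      rw [shift_apply, shift_apply, ← hdμ]; module
    rw [← map_smul, ← map_add, ← this, hY']
  obtain ⟨h1, -⟩ := (isBoundedInverseAt_bullet_iff hI hd).1 hR
  set M : ℝ := ‖Y‖ * (1 + ‖d‖ * ‖Y.comp I.adjoint‖ * (c * ‖I‖)) + 1 with hM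
  have hM0 : 0 < M := by positivity
  -- Orthogonality of `y` to `I* (ker L)` means `I y ∈ (ker L)ᗮ`. There `I y` is controlled by `L (I
  -- y) = I v`, where `v = Y (shift I T ζ y)`, and then `y = v + d Y I* I y` is controlled by `v`.
  refine ⟨(L : H →ₗ[ℂ] H).ker.map (I.adjoint : H →ₗ[ℂ] D), inferInstance, M⁻¹, by positivity,
    fun y hy => ?_⟩
  have hIy : I y ∈ (L : H →ₗ[ℂ] H).kerᗮ := fun w hw => by
    rw [← ContinuousLinearMap.adjoint_inner_left]
    exact hy _ ⟨w, hw, rfl⟩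
  have hLI : L (I y) = I (Y (shift I T ζ y)) := by
    obtain ⟨x, hx1, hx2⟩ := h1 (I y)
    have hx : Y (I.adjoint (I y)) = x := by rw [← hx2, hY']
    have := congrArg I (hkey y)
    rw [hx, map_add, map_smul, hx1] at this
    change I y - d • R (I y) = _
    exact sub_eq_iff_eq_add.2 this
  set v := Y (shift I T ζ y) with hv
  have e1 : ‖I y‖ ≤ c * (‖I‖ * ‖v‖) :=
    (hbound _ hIy).trans (by rw [hLI]; gcongr; exact I.le_opNorm v)
  have e2 : ‖Y (I.adjoint (I y))‖ ≤ ‖Y.comp I.adjoint‖ * ‖I y‖ :=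
    (Y.comp I.adjoint).le_opNorm (I y)
  have e3 : ‖v‖ ≤ ‖Y‖ * ‖shift I T ζ y‖ := Y.le_opNorm _
  have e4 : ‖y‖ ≤ ‖v‖ + ‖d‖ * ‖Y (I.adjoint (I y))‖ := by
    nth_rewrite 1 [hkey y]
    exact (norm_add_le _ _).trans (by rw [norm_smul])
  rw [inv_mul_le_iff₀ hM0]
  calc ‖y‖ ≤ ‖v‖ + ‖d‖ * (‖Y.comp I.adjoint‖ * (c * (‖I‖ * ‖v‖))) := by
        refine e4.trans ?_
        gcongr
        exact e2.trans (by gcongr)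
    _ = (1 + ‖d‖ * ‖Y.comp I.adjoint‖ * (c * ‖I‖)) * ‖v‖ := by ring
    _ ≤ (1 + ‖d‖ * ‖Y.comp I.adjoint‖ * (c * ‖I‖)) * (‖Y‖ * ‖shift I T ζ y‖) := by gcongr
    _ ≤ M * ‖shift I T ζ y‖ := by
        rw [hM]
        nlinarith [norm_nonneg (shift I T ζ y)]

end Rigging

namespace SemiboundedOperatorMatrix

open Rigging EssentialPositivity

variable {H₁ H₂ : Type*}
  [NormedAddCommGroup H₁] [InnerProductSpace ℂ H₁] [CompleteSpace H₁]
  [NormedAddCommGroup H₂] [InnerProductSpace ℂ H₂] [CompleteSpace H₂]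
  (M : SemiboundedOperatorMatrix H₁ H₂)

/-! ### The entries of `T` as operators in `D₁` and `D₂` -/

theorem formOp_T₂₂_apply (y : M.D₂) :
    formOp M.T₂₂ y = (M.τ : ℂ) • M.I₂.adjoint (M.I₂ y) - y := by
  have : formOp M.T₂₂ = (M.τ : ℂ) • M.I₂.adjoint.comp M.I₂ - 1 := formOp_eq fun y z => by
    rw [T₂₂_eq]
    simp [ContinuousLinearMap.adjoint_inner_right]
  rw [this]
  rfl

theorem formOp_T₁₁_apply (y : M.D₁) :
    formOp M.T₁₁ y = y - M.V.adjoint (M.V y) + (M.κ : ℂ) • M.I₁.adjoint (M.I₁ y) := by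
  have : formOp M.T₁₁ = 1 - M.V.adjoint.comp M.V + (M.κ : ℂ) • M.I₁.adjoint.comp M.I₁ :=
    formOp_eq fun y z => by
      rw [T₁₁_eq]
      simp [ContinuousLinearMap.adjoint_inner_right]
  rw [this]
  rfl

theorem isSymmetric_formOp_T₂₂ : (formOp M.T₂₂ : M.D₂ →ₗ[ℂ] M.D₂).IsSymmetric := fun x y => by
  change ⟪formOp M.T₂₂ x, y⟫_ℂ = ⟪x, formOp M.T₂₂ y⟫_ℂ
  simp only [formOp_T₂₂_apply, inner_sub_left, inner_sub_right, inner_smul_left, inner_smul_right,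
    Complex.conj_ofReal, ContinuousLinearMap.adjoint_inner_left,
    ContinuousLinearMap.adjoint_inner_right]

theorem isSymmetric_formOp_T₁₁ : (formOp M.T₁₁ : M.D₁ →ₗ[ℂ] M.D₁).IsSymmetric := fun x y => by
  change ⟪formOp M.T₁₁ x, y⟫_ℂ = ⟪x, formOp M.T₁₁ y⟫_ℂ
  simp only [formOp_T₁₁_apply, inner_sub_left, inner_sub_right, inner_add_left, inner_add_right,
    inner_smul_left, inner_smul_right, Complex.conj_ofReal, ContinuousLinearMap.adjoint_inner_left,
    ContinuousLinearMap.adjoint_inner_right]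

theorem formOp_T_apply (y : M.D) : formOp M.T y =
    WithLp.toLp 2 (formOp M.T₁₁ y.fst + M.V.adjoint y.snd, M.V y.fst + formOp M.T₂₂ y.snd) := by
  refine ext_inner_left ℂ fun z => ?_
  rw [inner_formOp, T_apply, WithLp.prod_inner_apply, T₁₂_eq, T₂₁_eq]
  simp [inner_add_right, inner_formOp, ContinuousLinearMap.adjoint_inner_right]

theorem isSymmetric_formOp_T : (formOp M.T : M.D →ₗ[ℂ] M.D).IsSymmetric := fun x y => by
  have h1 : ⟪formOp M.T₁₁ x.fst, y.fst⟫_ℂ = ⟪x.fst, formOp M.T₁₁ y.fst⟫_ℂ :=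
    M.isSymmetric_formOp_T₁₁ _ _
  have h2 : ⟪formOp M.T₂₂ x.snd, y.snd⟫_ℂ = ⟪x.snd, formOp M.T₂₂ y.snd⟫_ℂ :=
    M.isSymmetric_formOp_T₂₂ _ _
  change ⟪formOp M.T x, y⟫_ℂ = ⟪x, formOp M.T y⟫_ℂ
  rw [formOp_T_apply, formOp_T_apply, WithLp.prod_inner_apply, WithLp.prod_inner_apply]
  change ⟪formOp M.T₁₁ x.fst + M.V.adjoint x.snd, y.fst⟫_ℂ +
      ⟪M.V x.fst + formOp M.T₂₂ x.snd, y.snd⟫_ℂ =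
    ⟪x.fst, formOp M.T₁₁ y.fst + M.V.adjoint y.snd⟫_ℂ +
      ⟪x.snd, M.V y.fst + formOp M.T₂₂ y.snd⟫_ℂ
  simp only [inner_add_left, inner_add_right, h1, h2, ContinuousLinearMap.adjoint_inner_left,
    ContinuousLinearMap.adjoint_inner_right]
  ring

theorem adjoint_I_apply (h : M.H) :
    M.I.adjoint h = WithLp.toLp 2 (M.I₁.adjoint h.fst, M.I₂.adjoint h.snd) := by
  refine ext_inner_left ℂ fun z => ?_
  rw [ContinuousLinearMap.adjoint_inner_right, I_apply, WithLp.prod_inner_apply,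
    WithLp.prod_inner_apply]
  simp [ContinuousLinearMap.adjoint_inner_right]

/-- By the choice of the norm of `D₂` this operator is `-1`. -/
theorem surjective_T₂₂_sub : Function.Surjective
    (formOp M.T₂₂ - M.I₂.adjoint.comp (((M.τ : ℂ) • (1 : H₂ →L[ℂ] H₂)).comp M.I₂)) := fun u => by
  refine ⟨-u, ?_⟩
  change formOp M.T₂₂ (-u) - M.I₂.adjoint ((M.τ : ℂ) • M.I₂ (-u)) = u
  rw [formOp_T₂₂_apply, map_smul]
  abel

/-- The operator `diag(κ, τ)` in `H₁ ⊕ H₂`. -/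
def diagShift : M.H →L[ℂ] M.H :=
  (WithLp.prodContinuousLinearEquiv 2 ℂ H₁ H₂).symm.toContinuousLinearMap.comp
    ((((M.κ : ℂ) • (1 : H₁ →L[ℂ] H₁)).prodMap ((M.τ : ℂ) • (1 : H₂ →L[ℂ] H₂))).comp
      (WithLp.prodContinuousLinearEquiv 2 ℂ H₁ H₂).toContinuousLinearMap)

theorem diagShift_apply (h : M.H) :
    M.diagShift h = WithLp.toLp 2 ((M.κ : ℂ) • h.fst, (M.τ : ℂ) • h.snd) := rfl

/-- The block form is `(1 - V*V, V*; V, -1)`, whose Schur complement is the identity of `D₁`. This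
is the effect of the second term in the norm of `D₁`. -/
theorem surjective_T_sub :
    Function.Surjective (formOp M.T - M.I.adjoint.comp (M.diagShift.comp M.I)) := fun u => by
  set y := u.fst + M.V.adjoint u.snd with hy
  refine ⟨WithLp.toLp 2 (y, M.V y - u.snd), ?_⟩
  rw [sub_apply, ContinuousLinearMap.comp_apply, ContinuousLinearMap.comp_apply, formOp_T_apply,
    diagShift_apply, adjoint_I_apply, I_apply, formOp_T₁₁_apply, formOp_T₂₂_apply]
  refine WithLp.ofLp_injective 2 (Prod.ext ?_ ?_)
  · change y - M.V.adjoint (M.V y) + (M.κ : ℂ) • M.I₁.adjoint (M.I₁ y) +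
      M.V.adjoint (M.V y - u.snd) - M.I₁.adjoint ((M.κ : ℂ) • M.I₁ y) = u.fst
    rw [map_smul, map_sub, hy]
    abel
  · change M.V y + ((M.τ : ℂ) • M.I₂.adjoint (M.I₂ (M.V y - u.snd)) - (M.V y - u.snd)) -
      M.I₂.adjoint ((M.τ : ℂ) • M.I₂ (M.V y - u.snd)) = u.snd
    rw [map_smul]
    abel

/-! ### The transfer function -/

theorem T₂₂nat_eq (μ : ℂ) : M.T₂₂nat μ =
    (riesz M.D₂ : M.D₂ →L[ℂ] Antidual M.D₂).comp (shift M.I₂ M.T₂₂ μ) := by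
  ext y z
  simp [T₂₂nat, shift_apply, inner_formOp, ContinuousLinearMap.adjoint_inner_right]

/-- No condition on `μ` is needed: both inverses take the value `0` when the operator is not
invertible. -/
theorem formOp_S (μ : ℂ) : formOp (M.S μ) = shift M.I₁ M.T₁₁ μ -
    M.V.adjoint.comp ((Ring.inverse (shift M.I₂ M.T₂₂ μ)).comp M.V) := by
  have h : (M.T₂₂nat μ).inverse = (Ring.inverse (shift M.I₂ M.T₂₂ μ)).comp
      ((riesz M.D₂).symm : Antidual M.D₂ →L[ℂ] M.D₂) := by
    rw [T₂₂nat_eq, ContinuousLinearMap.inverse_equiv_comp, ContinuousLinearMap.ringInverse_eq_inverse]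
  have h2 : ∀ y, (riesz M.D₂).symm (M.T₂₁ y) = M.V y := fun y => by
    rw [T₂₁_eq]
    exact (riesz M.D₂).symm_apply_apply (M.V y)
  refine formOp_eq fun y z => ?_
  rw [S, h, T₁₂_eq]
  simp [shift_apply, inner_formOp, h2, ContinuousLinearMap.adjoint_inner_right]

theorem isSymmetric_formOp_S {μ : ℝ} (hμ : IsUnit (shift M.I₂ M.T₂₂ μ)) :
    (formOp (M.S μ) : M.D₁ →ₗ[ℂ] M.D₁).IsSymmetric := by
  have hN := isSymmetric_shift (I := M.I₂) M.isSymmetric_formOp_T₂₂ μ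
  set N := shift M.I₂ M.T₂₂ (μ : ℂ) with hNdef
  have hinv : ∀ x, N (Ring.inverse N x) = x := fun x =>
    congrArg (fun f : M.D₂ →L[ℂ] M.D₂ => f x) (Ring.mul_inverse_cancel N hμ)
  have hNi : ∀ x y, ⟪Ring.inverse N x, y⟫_ℂ = ⟪x, Ring.inverse N y⟫_ℂ := fun x y => by
    have : ⟪N (Ring.inverse N x), Ring.inverse N y⟫_ℂ =
      ⟪Ring.inverse N x, N (Ring.inverse N y)⟫_ℂ := hN _ _
    rw [hinv, hinv] at this
    exact this.symm
  intro x y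
  have h1 : ⟪shift M.I₁ M.T₁₁ μ x, y⟫_ℂ = ⟪x, shift M.I₁ M.T₁₁ μ y⟫_ℂ :=
    isSymmetric_shift M.isSymmetric_formOp_T₁₁ μ x y
  change ⟪formOp (M.S μ) x, y⟫_ℂ = ⟪x, formOp (M.S μ) y⟫_ℂ
  rw [formOp_S]
  simp only [sub_apply, ContinuousLinearMap.comp_apply, inner_sub_left, inner_sub_right, h1,
    ContinuousLinearMap.adjoint_inner_left, ContinuousLinearMap.adjoint_inner_right]
  rw [hNi]

theorem continuousAt_shift₂₂ (μ : ℝ) :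
    ContinuousAt (fun t : ℝ => shift M.I₂ M.T₂₂ (t : ℂ)) μ := by
  unfold shift
  fun_prop

theorem continuousAt_formOp_S {μ : ℝ} (hμ : IsUnit (shift M.I₂ M.T₂₂ μ)) :
    ContinuousAt (fun t : ℝ => formOp (M.S t)) μ := by
  simp only [formOp_S]
  have h1 : ContinuousAt (fun t : ℝ => shift M.I₁ M.T₁₁ (t : ℂ)) μ := by
    unfold shift
    fun_prop
  have h2 : ContinuousAt (fun t : ℝ => Ring.inverse (shift M.I₂ M.T₂₂ (t : ℂ))) μ := by
    obtain ⟨u, hu⟩ := hμ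
    have h3 := NormedRing.inverse_continuousAt u
    rw [hu] at h3
    exact ContinuousAt.comp (f := fun t : ℝ => shift M.I₂ M.T₂₂ (t : ℂ)) h3
      (M.continuousAt_shift₂₂ μ)
  exact h1.sub (continuousAt_const.clm_comp (h2.clm_comp continuousAt_const))

theorem essentiallyBoundedBelow_formOp_S {μ : ℂ} (hμ : IsUnit (shift M.I₂ M.T₂₂ μ))
    (h : EssentiallyBoundedBelow (shift M.I M.T μ)) :
    EssentiallyBoundedBelow (formOp (M.S μ)) := by
  obtain ⟨F, hF, c, hc, hb⟩ := h
  set N := shift M.I₂ M.T₂₂ μ with hN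
  have hinv : ∀ x, N (Ring.inverse N x) = x := fun x =>
    congrArg (fun f : M.D₂ →L[ℂ] M.D₂ => f x) (Ring.mul_inverse_cancel N hμ)
  -- The graph of `-(T₂₂ - μ)⁻¹ T₂₁`: on it `T - μ I* I` has second component `0` and first
  -- component `S(μ) x`.
  let Q : M.D₁ →L[ℂ] M.D :=
    (WithLp.prodContinuousLinearEquiv 2 ℂ M.D₁ M.D₂).symm.toContinuousLinearMap.comp
      ((1 : M.D₁ →L[ℂ] M.D₁).prod (-((Ring.inverse N).comp M.V)))
  have hQ : ∀ x, Q x = WithLp.toLp 2 (x, -(Ring.inverse N (M.V x))) := fun x => rfl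
  have hQS : ∀ x, shift M.I M.T μ (Q x) = WithLp.toLp 2 (formOp (M.S μ) x, 0) := fun x => by
    have h2 := hinv (M.V x)
    nth_rewrite 1 [hN] at h2
    rw [shift_apply] at h2
    rw [shift_apply, hQ, formOp_T_apply, I_apply, adjoint_I_apply, formOp_S]
    refine WithLp.ofLp_injective 2 (Prod.ext ?_ ?_)
    · change formOp M.T₁₁ x + M.V.adjoint (-(Ring.inverse N (M.V x))) -
          μ • M.I₁.adjoint (M.I₁ x) =
        formOp M.T₁₁ x - μ • M.I₁.adjoint (M.I₁ x) - M.V.adjoint (Ring.inverse N (M.V x))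
      rw [map_neg]
      abel
    · change M.V x + formOp M.T₂₂ (-(Ring.inverse N (M.V x))) -
        μ • M.I₂.adjoint (M.I₂ (-(Ring.inverse N (M.V x)))) = 0
      nth_rewrite 1 [← h2]
      rw [map_neg, map_neg, map_neg, smul_neg]
      abel
  -- Orthogonality of `x` to `Q* F` is orthogonality of `Q x` to `F`, and `‖x‖ ≤ ‖Q x‖` preserves
  -- the constant.
  refine ⟨F.map (Q.adjoint : M.D →ₗ[ℂ] M.D₁), inferInstance, c, hc, fun x hx => ?_⟩
  have h1 := hb (Q x) fun f hf => by
    rw [← ContinuousLinearMap.adjoint_inner_left]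
    exact hx _ ⟨f, hf, rfl⟩
  rw [hQS] at h1
  have h2 : ‖WithLp.toLp 2 (formOp (M.S μ) x, (0 : M.D₂))‖ = ‖formOp (M.S μ) x‖ :=
    WithLp.norm_toLp_fst _ _ _ _
  have h3 : ‖x‖ ≤ ‖Q x‖ := WithLp.norm_fst_le _ (Q x)
  rw [h2] at h1
  exact (mul_le_mul_of_nonneg_left h3 hc.le).trans h1

theorem isUnit_shift₂₂ {μ : ℂ} (h : μ ∈ M.T₂₂bullet.resolventSet) :
    IsUnit (shift M.I₂ M.T₂₂ μ) :=
  isUnit_shift M.I₂_injective M.denseRange_I₂ M.surjective_T₂₂_sub h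

theorem essentiallyBoundedBelow_formOp_S_of_mem {μ : ℂ}
    (h : μ ∈ M.Tbullet.resolventSet ∩ M.T₂₂bullet.resolventSet) :
    EssentiallyBoundedBelow (formOp (M.S μ)) := by
  obtain ⟨c, hc, hb⟩ := exists_bound_of_isUnit
    (isUnit_shift M.I_injective M.denseRange_I M.surjective_T_sub h.1)
  exact M.essentiallyBoundedBelow_formOp_S (M.isUnit_shift₂₂ h.2) (.of_bound hc hb)

theorem eventually_mem_resolventSet₂₂ {ζ : ℝ} (h : (ζ : ℂ) ∈ M.T₂₂bullet.resolventSet) :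
    ∀ᶠ t : ℝ in 𝓝 ζ, (t : ℂ) ∈ M.T₂₂bullet.resolventSet := by
  filter_upwards [(M.continuousAt_shift₂₂ ζ).eventually
    (Units.isOpen.mem_nhds (M.isUnit_shift₂₂ h))] with t ht
  exact mem_resolventSet_of_isUnit M.I₂_injective M.denseRange_I₂ ht

/-- On an interval of `ϱ(T₂₂^•)` on which `S` is essentially bounded below, essential positivity of
`σ S` for a fixed `σ ∈ ℝ` does not depend on the point. -/
theorem essentiallyPositive_smul_formOp_S {a b : ℝ}
    (h₂₂ : ∀ μ ∈ Set.Icc a b, (μ : ℂ) ∈ M.T₂₂bullet.resolventSet) {σ : ℝ} (hσ : σ ≠ 0)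
    (hb : ∀ μ ∈ Set.Icc a b, EssentiallyBoundedBelow (formOp (M.S (μ : ℂ)))) {s t : ℝ}
    (hs : s ∈ Set.Icc a b) (ht : t ∈ Set.Icc a b)
    (h : EssentiallyPositive ((σ : ℂ) • formOp (M.S (s : ℂ)))) :
    EssentiallyPositive ((σ : ℂ) • formOp (M.S (t : ℂ))) := by
  have : PreconnectedSpace (Set.Icc a b) := Subtype.preconnectedSpace isPreconnected_Icc
  refine EssentiallyPositive.of_preconnected
    (f := fun r : Set.Icc a b => (σ : ℂ) • formOp (M.S ((r : ℝ) : ℂ))) ?_ (fun r => ?_)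
    (fun r => ?_) (a := ⟨s, hs⟩) h ⟨t, ht⟩
  · have hcont : Continuous fun r : Set.Icc a b => formOp (M.S ((r : ℝ) : ℂ)) :=
      continuous_iff_continuousAt.2 fun r =>
        ContinuousAt.comp (f := fun r : Set.Icc a b => (r : ℝ))
          (g := fun t : ℝ => formOp (M.S (t : ℂ)))
          (M.continuousAt_formOp_S (M.isUnit_shift₂₂ (h₂₂ r r.2)))
          continuous_subtype_val.continuousAt
    exact hcont.const_smul (σ : ℂ)
  · intro x y
    have h1 : ⟪formOp (M.S ((r : ℝ) : ℂ)) x, y⟫_ℂ = ⟪x, formOp (M.S ((r : ℝ) : ℂ)) y⟫_ℂ :=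
      M.isSymmetric_formOp_S (M.isUnit_shift₂₂ (h₂₂ r r.2)) x y
    change ⟪(σ : ℂ) • formOp (M.S ((r : ℝ) : ℂ)) x, y⟫_ℂ =
      ⟪x, (σ : ℂ) • formOp (M.S ((r : ℝ) : ℂ)) y⟫_ℂ
    rw [inner_smul_left, inner_smul_right, h1, Complex.conj_ofReal]
  · obtain ⟨F, hF, c, hc, hbb⟩ := hb r r.2
    refine ⟨F, hF, |σ| * c, by positivity, fun x hx => ?_⟩
    rw [smul_apply, norm_smul, Complex.norm_real, Real.norm_eq_abs, mul_assoc]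
    exact mul_le_mul_of_nonneg_left (hbb x hx) (abs_nonneg _)

end SemiboundedOperatorMatrix

/-! ### Passing through the eigenvalue -/

namespace SemiboundedOperatorMatrix

open Rigging EssentialPositivity

variable {H₁ H₂ : Type*}
  [NormedAddCommGroup H₁] [InnerProductSpace ℂ H₁] [CompleteSpace H₁]
  [NormedAddCommGroup H₂] [InnerProductSpace ℂ H₂] [CompleteSpace H₂]
  (M : SemiboundedOperatorMatrix H₁ H₂)

/-- Essential positivity of `σ S` passes through an isolated eigenvalue `ζ` of finite
multiplicity of `T^•`. -/
theorem exists_forall_essentiallyPositive {ζ : ℝ} (hζ₂₂ : (ζ : ℂ) ∈ M.T₂₂bullet.resolventSet)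
    (hζ : M.Tbullet.IsIsolatedEigenvalueOfFiniteMultiplicity (ζ : ℂ)) {a b s σ : ℝ}
    (hζab : ζ ∈ Set.Icc a b) (hs : s ∈ Set.Icc a b)
    (hab : ∀ μ ∈ Set.Icc a b, μ ≠ ζ →
      (μ : ℂ) ∈ M.Tbullet.resolventSet ∩ M.T₂₂bullet.resolventSet)
    (hσ : σ ≠ 0) (h : EssentiallyPositive ((σ : ℂ) • formOp (M.S (s : ℂ)))) :
    ∃ r > 0, ∀ t : ℝ, |t - ζ| < r → t ≠ ζ →
      (t : ℂ) ∈ M.Tbullet.resolventSet ∩ M.T₂₂bullet.resolventSet ∧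
        EssentiallyPositive ((σ : ℂ) • formOp (M.S (t : ℂ))) := by
  have h₂₂ : ∀ μ ∈ Set.Icc a b, (μ : ℂ) ∈ M.T₂₂bullet.resolventSet := fun μ hμ => by
    by_cases hμζ : μ = ζ
    · rwa [hμζ]
    · exact (hab μ hμ hμζ).2
  have hbb : ∀ μ ∈ Set.Icc a b, EssentiallyBoundedBelow (formOp (M.S (μ : ℂ))) := fun μ hμ => by
    by_cases hμζ : μ = ζ
    · rw [hμζ]
      exact M.essentiallyBoundedBelow_formOp_S (M.isUnit_shift₂₂ hζ₂₂)
        (essentiallyBoundedBelow_shift M.I_injective M.denseRange_I M.isSymmetric_formOp_T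
          M.surjective_T_sub hζ)
    · exact M.essentiallyBoundedBelow_formOp_S_of_mem (hab μ hμ hμζ)
  -- The interval contains `ζ` itself: `S(ζ)` is defined since `ζ ∈ ϱ(T₂₂^•)`, although it need not
  -- be invertible.
  have hpos := M.essentiallyPositive_smul_formOp_S h₂₂ hσ hbb hs hζab h
  have hcont : ContinuousAt (fun t : ℝ => (σ : ℂ) • formOp (M.S (t : ℂ))) ζ :=
    (M.continuousAt_formOp_S (M.isUnit_shift₂₂ hζ₂₂)).const_smul (σ : ℂ)
  have hiso := eventually_nhdsWithin_iff.1 ((tendsto_ofReal_nhdsNE ζ).eventually hζ.2.2)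
  obtain ⟨r, hr, hball⟩ := Metric.eventually_nhds_iff.1
    ((hcont.eventually hpos.exists_nhds).and
      ((M.eventually_mem_resolventSet₂₂ hζ₂₂).and hiso))
  refine ⟨r, hr, fun t ht htζ => ?_⟩
  obtain ⟨h1, h2, h3⟩ := hball (by rwa [Real.dist_eq])
  exact ⟨⟨h3 htζ, h2⟩, h1⟩

end SemiboundedOperatorMatrix

end

theorem mainTheorem6 {H₁ H₂ : Type*}
    [NormedAddCommGroup H₁] [InnerProductSpace ℂ H₁] [CompleteSpace H₁]
    [NormedAddCommGroup H₂] [InnerProductSpace ℂ H₂] [CompleteSpace H₂]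
    (M : SemiboundedOperatorMatrix H₁ H₂) (ζ : ℝ)
    (hζ₂₂ : (ζ : ℂ) ∈ M.T₂₂bullet.resolventSet)
    (hζ : M.Tbullet.IsIsolatedEigenvalueOfFiniteMultiplicity (ζ : ℂ)) :
    (∀ ζm : ℝ, ζm < ζ →
      (∀ μ ∈ Set.Ico ζm ζ, (μ : ℂ) ∈ M.Tbullet.resolventSet ∩ M.T₂₂bullet.resolventSet) →
      Rigging.IsCompactPerturbationOfUniformlyPositive (M.S (ζm : ℂ)) →
      ∃ ζp : ℝ, ζ < ζp ∧
        (∀ μ ∈ Set.Ioc ζ ζp, (μ : ℂ) ∈ M.Tbullet.resolventSet ∩ M.T₂₂bullet.resolventSet) ∧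
        Rigging.IsCompactPerturbationOfUniformlyPositive (M.S (ζp : ℂ))) ∧
    (∀ ζp : ℝ, ζ < ζp →
      (∀ μ ∈ Set.Ioc ζ ζp, (μ : ℂ) ∈ M.Tbullet.resolventSet ∩ M.T₂₂bullet.resolventSet) →
      Rigging.IsCompactPerturbationOfUniformlyNegative (M.S (ζp : ℂ)) →
      ∃ ζm : ℝ, ζm < ζ ∧
        (∀ μ ∈ Set.Ico ζm ζ, (μ : ℂ) ∈ M.Tbullet.resolventSet ∩ M.T₂₂bullet.resolventSet) ∧
        Rigging.IsCompactPerturbationOfUniformlyNegative (M.S (ζm : ℂ))) := by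
  constructor
  · intro ζm hlt hres hS
    -- Propagate along `[ζm, ζ]`, from left to right.
    obtain ⟨r, hr, h⟩ := M.exists_forall_essentiallyPositive hζ₂₂ hζ (σ := 1)
      (Set.right_mem_Icc.2 hlt.le) (Set.left_mem_Icc.2 hlt.le)
      (fun μ hμ hne => hres μ ⟨hμ.1, lt_of_le_of_ne hμ.2 hne⟩) one_ne_zero
      (by simpa using Rigging.essentiallyPositive_formOp hS)
    have hmem : ∀ μ ∈ Set.Ioc ζ (ζ + r / 2), |μ - ζ| < r ∧ μ ≠ ζ := fun μ hμ =>
      ⟨by rw [abs_lt]; constructor <;> linarith [hμ.1, hμ.2], hμ.1.ne'⟩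
    refine ⟨ζ + r / 2, by linarith, fun μ hμ => (h μ (hmem μ hμ).1 (hmem μ hμ).2).1, ?_⟩
    obtain ⟨h1, h2⟩ := hmem (ζ + r / 2) ⟨by linarith, le_rfl⟩
    obtain ⟨h3, h4⟩ := h _ h1 h2
    exact Rigging.isCompactPerturbation_of_essentiallyPositive
      (M.isSymmetric_formOp_S (M.isUnit_shift₂₂ h3.2)) (by simpa using h4)
  · intro ζp hlt hres hS
    rw [Rigging.isCompactPerturbationOfUniformlyNegative_iff] at hS
    -- Propagate the positivity of `-S` along `[ζ, ζp]`, from right to left.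
    obtain ⟨r, hr, h⟩ := M.exists_forall_essentiallyPositive hζ₂₂ hζ (σ := -1)
      (Set.left_mem_Icc.2 hlt.le) (Set.right_mem_Icc.2 hlt.le)
      (fun μ hμ hne => hres μ ⟨lt_of_le_of_ne hμ.1 (Ne.symm hne), hμ.2⟩) (by norm_num)
      (by simpa [Rigging.formOp_neg] using Rigging.essentiallyPositive_formOp hS)
    have hmem : ∀ μ ∈ Set.Ico (ζ - r / 2) ζ, |μ - ζ| < r ∧ μ ≠ ζ := fun μ hμ =>
      ⟨by rw [abs_lt]; constructor <;> linarith [hμ.1, hμ.2], hμ.2.ne⟩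
    refine ⟨ζ - r / 2, by linarith, fun μ hμ => (h μ (hmem μ hμ).1 (hmem μ hμ).2).1, ?_⟩
    obtain ⟨h1, h2⟩ := hmem (ζ - r / 2) ⟨le_rfl, by linarith⟩
    obtain ⟨h3, h4⟩ := h _ h1 h2
    rw [Rigging.isCompactPerturbationOfUniformlyNegative_iff]
    have hsymm := M.isSymmetric_formOp_S (M.isUnit_shift₂₂ h3.2)
    refine Rigging.isCompactPerturbation_of_essentiallyPositive ?_
      (by simpa [Rigging.formOp_neg] using h4)
    rw [Rigging.formOp_neg]
    intro x y
    have h5 : ⟪Rigging.formOp (M.S ((ζ - r / 2 : ℝ) : ℂ)) x, y⟫_ℂ =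
      ⟪x, Rigging.formOp (M.S ((ζ - r / 2 : ℝ) : ℂ)) y⟫_ℂ := hsymm x y
    change ⟪-(Rigging.formOp (M.S ((ζ - r / 2 : ℝ) : ℂ)) x), y⟫_ℂ =
      ⟪x, -(Rigging.formOp (M.S ((ζ - r / 2 : ℝ) : ℂ)) y)⟫_ℂ
    rw [inner_neg_left, inner_neg_right, h5]
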